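/- A correlation graph is a finite complete simple graph whose edges are each coloured either blue or red; an incomplete correlation graph is a finite simple graph, not necessarily complete, with such a colouring. A permissive vertex split of a vertex $v$ in an (incomplete) correlation graph replaces $v$ by two new vertices $v_1,v_2$ such that every red (blue) neighbour of $v$ becomes a red (blue) neighbour of at least one of $v_1,v_2$; edges not incident to $v$ are kept, and all further edges incident to $v_1$ or $v_2$ are chosen arbitrarily (blue, red or absent). A sequence of splits clusters a graph if the resulting graph contains no simple cycle with exactly one red edge. The problem Cluster Editing with Permissive Vertex Splitting asks, for a correlation graph $G$ and an integer $k\ge 0$, whether some sequence of at most $k$ permissive vertex splits clusters $G$. Theorem. Cluster Editing with Permissive Vertex Splitting, parameterized by the number $k$ of vertex splits, admits a polynomial-time kernelization with $O(k^3)$ vertices. Precisely, there is an algorithm (a program for a unit-cost random access machine with addition and truncated subtraction) that, given a correlation graph $G$ on $n$ vertices and an integer $k\ge 0$, runs in time polynomial in $n$ and the binary length of $k$ and outputs a correlation graph $G'$ and an integer $0\le k'\le k$ such that $(G,k)$ is a yes-instance if and only if $(G',k')$ is a yes-instance, and $G'$ has at most $24k^3+24k^2+3k$ vertices, except that when $k=0$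 and $(G,0)$ is a no-instance, $G'$ has at most $3$ vertices. -/

import Mathlib

/-! ### Correlation graphs and permissive vertex splits -/

universe u

/-- An incomplete correlation graph on the vertex set `V`: two disjoint (simple, undirected) edge
relations, blue and red. -/
structure IncompleteCorrelationGraph (V : Type u) where
  blue : SimpleGraph V
  red : SimpleGraph V
  disjoint : ∀ x y, blue.Adj x y → ¬ red.Adj x y

/-- A correlation graph: every pair of distinct vertices is joined by a blue or a red edge. -/
structure CorrelationGraph (V : Type u) extends IncompleteCorrelationGraph V where
  complete : ∀ x y, x ≠ y → blue.Adj x y ∨ red.Adj x y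

namespace IncompleteCorrelationGraph

/-- `G` contains an erroneous cycle: a simple cycle with exactly one red edge. -/
def HasErroneousCycle {V : Type u} (G : IncompleteCorrelationGraph V) : Prop :=
  ∃ (x : V) (c : (G.blue ⊔ G.red).Walk x x),
    c.IsCycle ∧ ∃! e : Sym2 V, e ∈ c.edges ∧ e ∈ G.red.edgeSet

/-- `G'` arises from `G` by a permissive vertex split of `v`. The two vertices which replace `v`
are `some v` and `none`; any other vertex `x` of `G` is the vertex `some x` of `G'`. Edges between
vertices other than `v` are kept, each red (blue) neighbour of `v` is a red (blue) neighbour of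
at least one of the two copies, and all further edges at the two copies are arbitrary. -/
structure IsPermissiveSplit {V : Type u} (G : IncompleteCorrelationGraph V) (v : V)
    (G' : IncompleteCorrelationGraph (Option V)) : Prop where
  blue_iff : ∀ x y, x ≠ v → y ≠ v → (G'.blue.Adj (some x) (some y) ↔ G.blue.Adj x y)
  red_iff : ∀ x y, x ≠ v → y ≠ v → (G'.red.Adj (some x) (some y) ↔ G.red.Adj x y)
  red_neighbor : ∀ x, G.red.Adj v x → G'.red.Adj (some v) (some x) ∨ G'.red.Adj none (some x)
  blue_neighbor : ∀ x, G.blue.Adj v x → G'.blue.Adj (some v) (some x) ∨ G'.blue.Adj none (some x)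

/-- Some sequence of exactly `m` permissive vertex splits clusters `G`, i.e. the resulting graph
has no erroneous cycle. -/
def ClusteredBySplits : (m : ℕ) → {V : Type u} → IncompleteCorrelationGraph V → Prop
  | 0, _, G => ¬ G.HasErroneousCycle
  | m + 1, V, G => ∃ (v : V) (G' : IncompleteCorrelationGraph (Option V)),
      G.IsPermissiveSplit v G' ∧ ClusteredBySplits m G'

end IncompleteCorrelationGraph

/-- `(G, k)` is a yes-instance of Cluster Editing with Permissive Vertex Splitting: some sequence
of at most `k` permissive vertex splits clusters the correlation graph `G`. -/
def CorrelationGraph.IsYesInstance {V : Type u} (G : CorrelationGraph V) (k : ℕ) : Prop :=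
  ∃ m ≤ k, G.toIncompleteCorrelationGraph.ClusteredBySplits m

/-! ### Random access machines with unit costs

Programs over natural-number registers and arrays. The only arithmetic operations are addition
and truncated subtraction, so that numbers grow by at most one bit per step and the machine is
polynomially equivalent to a Turing machine. -/

namespace RAM

/-- A memory state: the registers and, for each array name, the array's cells. -/
structure State where
  reg : ℕ → ℕ
  arr : ℕ → ℕ → ℕ

/-- Write `w` into register `x`. -/
def State.setReg (s : State) (x w : ℕ) : State where
  reg := Function.update s.reg x w
  arr := s.arr

/-- Write `w` into the cell with index `i` of array `a`. -/
def State.setCell (s : State) (a i w : ℕ) : State where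
  reg := s.reg
  arr := Function.update s.arr a (Function.update (s.arr a) i w)

/-- Expressions. `load a e` reads the cell of array `a` whose index is the value of `e`. -/
inductive Expr where
  | const (c : ℕ)
  | reg (x : ℕ)
  | load (a : ℕ) (e : Expr)
  | add (e₁ e₂ : Expr)
  | sub (e₁ e₂ : Expr)

def Expr.eval (s : State) : Expr → ℕ
  | .const c => c
  | .reg x => s.reg x
  | .load a e => s.arr a (e.eval s)
  | .add e₁ e₂ => e₁.eval s + e₂.eval s
  | .sub e₁ e₂ => e₁.eval s - e₂.eval s

/-- The number of steps for the evaluation of an expression: one for each operation in it. -/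
def Expr.cost : Expr → ℕ
  | .const _ => 1
  | .reg _ => 1
  | .load _ e => e.cost + 1
  | .add e₁ e₂ => e₁.cost + e₂.cost + 1
  | .sub e₁ e₂ => e₁.cost + e₂.cost + 1

/-- Programs. In `ite` and `loop` (a while loop), a condition holds when its value is not `0`. -/
inductive Program where
  | skip
  | assign (x : ℕ) (e : Expr)
  | store (a : ℕ) (i e : Expr)
  | seq (p q : Program)
  | ite (e : Expr) (p q : Program)
  | loop (e : Expr) (p : Program)

/-- `Run p s t s'`: started in the state `s`, the program `p` halts after exactly `t` steps, in the
state `s'`. -/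
inductive Run : Program → State → ℕ → State → Prop where
  | skip (s : State) : Run .skip s 1 s
  | assign (s : State) (x : ℕ) (e : Expr) :
      Run (.assign x e) s (e.cost + 1)
        (s.setReg x (e.eval s))
  | store (s : State) (a : ℕ) (i e : Expr) :
      Run (.store a i e) s (i.cost + e.cost + 1)
        (s.setCell a (i.eval s) (e.eval s))
  | seq {p q : Program} {s s' s'' : State} {t t' : ℕ} :
      Run p s t s' → Run q s' t' s'' → Run (.seq p q) s (t + t') s''
  | ite_true {e : Expr} {p q : Program} {s s' : State} {t : ℕ} :
      e.eval s ≠ 0 → Run p s t s' → Run (.ite e p q) s (e.cost + 1 + t) s'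
  | ite_false {e : Expr} {p q : Program} {s s' : State} {t : ℕ} :
      e.eval s = 0 → Run q s t s' → Run (.ite e p q) s (e.cost + 1 + t) s'
  | loop_done {e : Expr} {p : Program} {s : State} :
      e.eval s = 0 → Run (.loop e p) s (e.cost + 1) s
  | loop_step {e : Expr} {p : Program} {s s' s'' : State} {t t' : ℕ} :
      e.eval s ≠ 0 → Run p s t s' → Run (.loop e p) s' t' s'' →
        Run (.loop e p) s (e.cost + 1 + t + t') s''

/-- The `0`-`1` entry for the pair `(i, j)` in the blue adjacency matrix of `G`. -/
noncomputable def blueEntry {n : ℕ} (G : CorrelationGraph (Fin n)) (i j : Fin n) : ℕ :=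
  open Classical in if G.blue.Adj i j then 1 else 0

/-- The state `s` contains the instance `(G, k)`: the number of vertices is in register `0`, `k` in
register `1`, and the blue adjacency matrix of `G`, row by row, in array `0`. -/
structure Holds (s : State) {n : ℕ} (G : CorrelationGraph (Fin n)) (k : ℕ) : Prop where
  reg_zero : s.reg 0 = n
  reg_one : s.reg 1 = k
  matrix : ∀ i j : Fin n, s.arr 0 (i * n + j) = blueEntry G i j

/-- The state in which a computation on the instance `(G, k)` starts: the memory contains `(G, k)`
and is zero elsewhere. -/
structure IsInitial (s : State) {n : ℕ} (G : CorrelationGraph (Fin n)) (k : ℕ) : Prop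
    extends Holds s G k where
  reg_rest : ∀ x, 2 ≤ x → s.reg x = 0
  matrix_rest : ∀ i, n * n ≤ i → s.arr 0 i = 0
  arr_rest : ∀ a i, 1 ≤ a → s.arr a i = 0

end RAM

/-! ### Splitting as overlapping clustering -/

namespace IncompleteCorrelationGraph

/-! A graph has no erroneous cycle exactly when no red edge joins two vertices of one blue
component. Recording in which clusters the copies of a vertex end up turns a split sequence into an
assignment of nonempty sets `F v`: blue neighbours share a cluster, red neighbours do not both carry
the same singleton, and `v` costs `|F v| - 1` splits. `isYesInstance_iff` is this translation.

A bad triple, that is an induced blue path on three vertices, contains a vertex with at least two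
clusters. So in a yes-instance a maximal family of disjoint bad triples has at most `k` members. Its
vertex set `X` then has at most `3k` elements and meets every bad triple, hence the blue graph
outside `X` is a disjoint union of cliques. A vertex `v` of `X` has blue neighbours in at most `2k +
1` of these cliques (`card_firsts_le`). If one of the two bounds fails, a single bad triple with
parameter `0` is a correct output.

Otherwise, for each `v` in `X` and each clique which `v` touches, keep up to `k + 1` blue and up to
`k + 1` red neighbours of `v`. This leaves at most `3k + 3k(2k + 1)(2k + 2)` vertices
(`card_le_of_isKept`). Deleting the others is safe (`exists_extension`): a clustering of cost at
most `k` leaves one of any `k + 1` kept twins unsplit, all unsplit vertices of a clique lie in the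
same cluster, and the deleted vertices of the clique can join it.

The computation consists of nested loops of length `n`, so its running time is polynomial in `n`
whatever the size of `k`. -/

/-- `F` assigns to each vertex the set of clusters of its copies: blue neighbours share a cluster,
and red neighbours have copies in different clusters. -/
structure IsOverlappingClustering {V : Type u} (G : IncompleteCorrelationGraph V)
    (F : V → Finset ℕ) : Prop where
  nonempty : ∀ v, (F v).Nonempty
  blue : ∀ x y, G.blue.Adj x y → (F x ∩ F y).Nonempty
  red : ∀ x y, G.red.Adj x y → 1 < (F x ∪ F y).card

/-- The number of vertex splits which produce the copies prescribed by `F`. -/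
def splitCost {V : Type u} [Fintype V] (F : V → Finset ℕ) : ℕ := ∑ v, ((F v).card - 1)

/-! ### Split sequences versus overlapping clusterings -/

variable {V : Type u} {G : IncompleteCorrelationGraph V}

/-- A blue path between the ends of a red edge closes up to a cycle whose only red edge is the given
one. -/
theorem hasErroneousCycle_of_reachable {x y : V} (hr : G.red.Adj x y)
    (hb : G.blue.Reachable x y) : G.HasErroneousCycle := by
  classical
  obtain ⟨p, hp⟩ := hb.exists_isPath
  have hle : G.blue ≤ G.blue ⊔ G.red := le_sup_left
  have hred : (G.blue ⊔ G.red).Adj y x := Or.inr hr.symm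
  have hblue : ∀ e ∈ p.edges, e ∉ G.red.edgeSet := by
    intro e
    induction e with
    | _ a b => exact fun he => G.disjoint a b (p.adj_of_mem_edges he)
  refine ⟨y, .cons hred (p.mapLe hle), ?_, s(y, x), ?_, ?_⟩
  · rw [SimpleGraph.Walk.cons_isCycle_iff]
    refine ⟨hp.mapLe hle, fun h => ?_⟩
    rw [SimpleGraph.Walk.edges_mapLe_eq_edges] at h
    exact hblue _ h hr.symm
  · simp [hr.symm]
  · rintro e ⟨he, her⟩
    rw [SimpleGraph.Walk.edges_cons, List.mem_cons, SimpleGraph.Walk.edges_mapLe_eq_edges] at he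
    exact he.resolve_right fun h => hblue e h her

theorem exists_isOverlappingClustering_of_not_hasErroneousCycle [Fintype V]
    (h : ¬ G.HasErroneousCycle) :
    ∃ F, G.IsOverlappingClustering F ∧ splitCost F = 0 := by
  classical
  obtain ⟨f, hf⟩ := Countable.exists_injective_nat G.blue.ConnectedComponent
  refine ⟨fun v => {f (G.blue.connectedComponentMk v)}, ⟨by simp, ?_, ?_⟩, by simp [splitCost]⟩
  · intro x y hxy
    rw [SimpleGraph.ConnectedComponent.sound hxy.reachable]
    simp
  · intro x y hxy
    have hne : f (G.blue.connectedComponentMk x) ≠ f (G.blue.connectedComponentMk y) := fun he =>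
      h (hasErroneousCycle_of_reachable hxy (SimpleGraph.ConnectedComponent.exact (hf he)))
    rw [← Finset.insert_eq, Finset.card_pair hne]
    exact one_lt_two

/-- The value of `f` changes only at red edges, so a single red step changes it for good. The edges
must be distinct, since otherwise the unique red edge could be crossed twice. Applied to a closed
walk, this excludes erroneous cycles. -/
theorem ne_of_existsUnique_red_edge {α : Type*} {f : V → α}
    (hb : ∀ x y, G.blue.Adj x y → f x = f y) (hr : ∀ x y, G.red.Adj x y → f x ≠ f y)
    {x y : V} (c : (G.blue ⊔ G.red).Walk x y) (hc : c.edges.Nodup)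
    (h : ∃! e : Sym2 V, e ∈ c.edges ∧ e ∈ G.red.edgeSet) : f x ≠ f y := by
  have key : ∀ {x y : V} (c : (G.blue ⊔ G.red).Walk x y),
      (∀ e ∈ c.edges, e ∉ G.red.edgeSet) → f x = f y := by
    intro x y c
    induction c with
    | nil => exact fun _ => rfl
    | @cons a b d hadj p ih =>
      intro hp
      rw [← ih fun e he => hp e (by simp [he])]
      exact hb a b (hadj.resolve_right fun h => hp s(a, b) (by simp) h)
  induction c with
  | nil => obtain ⟨e, he, _⟩ := h; simp at he
  | @cons a b d hadj p ih =>
    rw [SimpleGraph.Walk.edges_cons, List.nodup_cons] at hc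
    obtain ⟨e, ⟨he, her⟩, hu⟩ := h
    by_cases hab : G.red.Adj a b
    · rw [← key p]
      · exact hr a b hab
      · intro e' he' her'
        have h1 := hu e' ⟨by simp [he'], her'⟩
        have h2 := hu s(a, b) ⟨by simp, hab⟩
        exact hc.1 (h2.trans h1.symm ▸ he')
    · rw [hb a b (hadj.resolve_right hab)]
      refine ih hc.2 ⟨e, ⟨?_, her⟩, fun e' he' => hu e' ⟨by simp [he'.1], he'.2⟩⟩
      rw [SimpleGraph.Walk.edges_cons, List.mem_cons] at he
      refine he.resolve_left fun h => hab ?_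
      rw [h] at her
      exact her

theorem IsOverlappingClustering.not_hasErroneousCycle [Fintype V] {F : V → Finset ℕ}
    (hF : G.IsOverlappingClustering F) (h0 : splitCost F = 0) : ¬ G.HasErroneousCycle := by
  rintro ⟨x, c, hc, hu⟩
  have hcard : ∀ v, ∃ D, F v = {D} := by
    intro v
    have h1 := Finset.sum_eq_zero_iff.1 h0 v (Finset.mem_univ v)
    have h2 := (hF.nonempty v).card_pos
    exact Finset.card_eq_one.1 (by omega)
  refine ne_of_existsUnique_red_edge (f := F) ?_ ?_ c hc.isTrail.edges_nodup hu rfl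
  · intro x y hxy
    obtain ⟨D, hD⟩ := hcard x
    obtain ⟨E, hE⟩ := hcard y
    obtain ⟨z, hz⟩ := hF.blue x y hxy
    simp only [hD, hE, Finset.mem_inter, Finset.mem_singleton] at hz
    rw [hD, hE, ← hz.1, ← hz.2]
  · intro x y hxy he
    have h1 := hF.red x y hxy
    obtain ⟨D, hD⟩ := hcard y
    simp [he, hD] at h1

/-- Undoing a split gives `v` the union of the cluster sets `A`, `B` of its copies. Since `|A ∪ B| -
1 ≤ (|A| - 1) + (|B| - 1) + 1`, the cost grows by at most one, which pays for the split. -/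
theorem exists_isOverlappingClustering_of_clusteredBySplits (m : ℕ) :
    ∀ {V : Type u} [Fintype V] (G : IncompleteCorrelationGraph V), G.ClusteredBySplits m →
      ∃ F, G.IsOverlappingClustering F ∧ splitCost F ≤ m := by
  classical
  induction m with
  | zero =>
    intro V _ G h
    obtain ⟨F, hF, h0⟩ := exists_isOverlappingClustering_of_not_hasErroneousCycle h
    exact ⟨F, hF, h0.le⟩
  | succ m ih =>
    rintro V _ G ⟨v, G', hs, h⟩
    obtain ⟨F', hF', hc⟩ := ih G' h
    let F : V → Finset ℕ := fun x => if x = v then F' (some v) ∪ F' none else F' (some x)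
    have hsub : ∀ x, F' (some x) ⊆ F x := by
      intro x
      by_cases hx : x = v
      · subst hx; simp [F]
      · simp [F, hx]
    have hsub' : F' none ⊆ F v := by simp [F]
    have hb : ∀ x, G.blue.Adj v x → (F v ∩ F x).Nonempty := by
      intro x hx
      rcases hs.blue_neighbor x hx with h | h
      · exact (hF'.blue _ _ h).mono (Finset.inter_subset_inter (hsub v) (hsub x))
      · exact (hF'.blue _ _ h).mono (Finset.inter_subset_inter hsub' (hsub x))
    have hr : ∀ x, G.red.Adj v x → 1 < (F v ∪ F x).card := by
      intro x hx
      rcases hs.red_neighbor x hx with h | h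
      · exact (hF'.red _ _ h).trans_le
          (Finset.card_le_card (Finset.union_subset_union (hsub v) (hsub x)))
      · exact (hF'.red _ _ h).trans_le
          (Finset.card_le_card (Finset.union_subset_union hsub' (hsub x)))
    refine ⟨F, ⟨fun x => (hF'.nonempty _).mono (hsub x), fun x y hxy => ?_, fun x y hxy => ?_⟩, ?_⟩
    · by_cases hx : x = v
      · subst hx; exact hb y hxy
      by_cases hy : y = v
      · subst hy; rw [Finset.inter_comm]; exact hb x hxy.symm
      exact (hF'.blue _ _ ((hs.blue_iff x y hx hy).2 hxy)).mono
        (Finset.inter_subset_inter (hsub x) (hsub y))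
    · by_cases hx : x = v
      · subst hx; exact hr y hxy
      by_cases hy : y = v
      · subst hy; rw [Finset.union_comm]; exact hr x hxy.symm
      exact (hF'.red _ _ ((hs.red_iff x y hx hy).2 hxy)).trans_le
        (Finset.card_le_card (Finset.union_subset_union (hsub x) (hsub y)))
    · have h1 : splitCost F' = ((F' none).card - 1) + ∑ x, ((F' (some x)).card - 1) :=
        Fintype.sum_option _
      have h2 : ∀ x, (F x).card - 1 ≤
          ((F' (some x)).card - 1) + if x = v then (F' none).card else 0 := by
        intro x
        by_cases hx : x = v
        · subst hx
          have h3 := Finset.card_union_le (F' (some x)) (F' none)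
          have h4 := (hF'.nonempty (some x)).card_pos
          simp only [F, if_true]
          omega
        · simp [F, hx]
      have h3 : splitCost F ≤ ∑ x, ((F' (some x)).card - 1) + (F' none).card :=
        (Finset.sum_le_sum fun x _ => h2 x).trans (by simp [Finset.sum_add_distrib])
      have h4 := (hF'.nonempty none).card_pos
      omega

/-- Pull `G` back along `π` and keep only the edges for which `F` does what is needed. -/
def pullback {W : Type u} (G : IncompleteCorrelationGraph V) (π : W → V) (F : W → Finset ℕ) :
    IncompleteCorrelationGraph W where
  blue :=
    { Adj := fun a b => G.blue.Adj (π a) (π b) ∧ (F a ∩ F b).Nonempty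
      symm := ⟨fun a b h => ⟨h.1.symm, by rw [Finset.inter_comm]; exact h.2⟩⟩
      loopless := ⟨fun a h => G.blue.irrefl h.1⟩ }
  red :=
    { Adj := fun a b => G.red.Adj (π a) (π b) ∧ 1 < (F a ∪ F b).card
      symm := ⟨fun a b h => ⟨h.1.symm, by rw [Finset.union_comm]; exact h.2⟩⟩
      loopless := ⟨fun a h => G.red.irrefl h.1⟩ }
  disjoint := fun a b h h' => G.disjoint _ _ h.1 h'.1

/-- While the cost is positive, some `v` has a spare cluster `D`. Splitting off a copy which carries
only `D` and removing `D` from the other copy lowers the cost by one. -/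
theorem IsOverlappingClustering.clusteredBySplits (m : ℕ) :
    ∀ {V : Type u} [Fintype V] {G : IncompleteCorrelationGraph V} {F : V → Finset ℕ},
      G.IsOverlappingClustering F → splitCost F = m → G.ClusteredBySplits m := by
  classical
  induction m with
  | zero => exact fun hF h0 => hF.not_hasErroneousCycle h0
  | succ m ih =>
    intro V _ G F hF hm
    obtain ⟨v, hv⟩ : ∃ v, 1 < (F v).card := by
      by_contra! hcon
      have : splitCost F = 0 := Finset.sum_eq_zero fun v _ => by have := hcon v; omega
      omega
    obtain ⟨D, hD⟩ := hF.nonempty v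
    let F' : Option V → Finset ℕ := fun a => a.elim {D} fun x => if x = v then (F v).erase D else F x
    let π : Option V → V := fun a => a.elim v id
    have hv' : F' (some v) = (F v).erase D := by simp [F']
    have hx' : ∀ x, x ≠ v → F' (some x) = F x := fun x hx => by simp [F', hx]
    have hn' : F' none = {D} := rfl
    have herase : ((F v).erase D).card = (F v).card - 1 := Finset.card_erase_of_mem hD
    refine ⟨v, G.pullback π F', ⟨?_, ?_, ?_, ?_⟩, ih (F := F') ⟨?_, ?_, ?_⟩ ?_⟩
    · intro x y hx hy
      simp only [pullback, π, hx' x hx, hx' y hy, Option.elim, id]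
      exact and_iff_left_of_imp (hF.blue x y)
    · intro x y hx hy
      simp only [pullback, π, hx' x hx, hx' y hy, Option.elim, id]
      exact and_iff_left_of_imp (hF.red x y)
    · intro x hx
      by_cases h : 1 < ({D} ∪ F x).card
      · right
        exact ⟨hx, by rw [hn', hx' x hx.ne']; exact h⟩
      · left
        refine ⟨hx, ?_⟩
        rw [hv', hx' x hx.ne']
        -- The union with `{D}` is too small, so `F x = {D}`. Any other cluster `z` of `v` then
        -- separates the remaining copy from `x`.
        obtain ⟨z, hz⟩ : ((F v).erase D).Nonempty := Finset.card_pos.1 (by omega)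
        obtain ⟨w, hw⟩ := hF.nonempty x
        have hwD : w = D := by
          by_contra hne
          exact h (Finset.one_lt_card.2 ⟨w, by simp [hw], D, by simp, hne⟩)
        exact Finset.one_lt_card.2 ⟨z, by simp at hz ⊢; simp [hz], w, by simp [hw],
          by rw [hwD]; exact (Finset.mem_erase.1 hz).1⟩
    · intro x hx
      obtain ⟨z, hz⟩ := hF.blue v x hx
      rw [Finset.mem_inter] at hz
      by_cases h : z = D
      · right
        exact ⟨hx, z, by rw [hn', hx' x hx.ne']; simp [h ▸ hz.2, h]⟩
      · left
        exact ⟨hx, z, by rw [hv', hx' x hx.ne']; simp [hz, h]⟩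
    · rintro (_ | x)
      · simp [hn']
      · by_cases hx : x = v
        · rw [hx, hv']
          exact Finset.card_pos.1 (by omega)
        · rw [hx' x hx]
          exact hF.nonempty x
    · exact fun _ _ h => h.2
    · exact fun _ _ h => h.2
    · have h1 : splitCost F' = ∑ x, ((F' (some x)).card - 1) := by
        rw [splitCost, Fintype.sum_option]
        simp [hn']
      have h2 : splitCost F = ∑ x, (((F' (some x)).card - 1) + if x = v then 1 else 0) := by
        refine Finset.sum_congr rfl fun x _ => ?_
        by_cases hx : x = v
        · subst hx
          rw [hv', herase, if_pos rfl]
          omega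
        · simp [hx' x hx, hx]
      rw [Finset.sum_add_distrib] at h2
      simp at h2
      omega

end IncompleteCorrelationGraph

theorem CorrelationGraph.isYesInstance_iff {V : Type u} [Fintype V] (G : CorrelationGraph V)
    (k : ℕ) : G.IsYesInstance k ↔ ∃ F, G.IsOverlappingClustering F ∧
      IncompleteCorrelationGraph.splitCost F ≤ k := by
  constructor
  · rintro ⟨m, hm, h⟩
    obtain ⟨F, hF, hc⟩ := G.exists_isOverlappingClustering_of_clusteredBySplits m h
    exact ⟨F, hF, hc.trans hm⟩
  · rintro ⟨F, hF, hc⟩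
    exact ⟨_, hc, hF.clusteredBySplits _ rfl⟩

/-! ### The vertices which a kernel keeps -/

/-- Counting predecessors is injective on `S`, with image the numbers below `S.card`. -/
theorem Finset.card_filter_card_filter_lt_le {α : Type*} [LinearOrder α] (S : Finset α) (k : ℕ) :
    (S.filter fun x => (S.filter fun y => y < x).card ≤ k).card = min S.card (k + 1) := by
  set r : α → ℕ := fun x => (S.filter fun y => y < x).card with hr
  have hmono : ∀ x ∈ S, ∀ y, x < y → r x < r y := fun x hx y hxy =>
    Finset.card_lt_card ⟨fun z hz => by
      simp only [Finset.mem_filter] at hz ⊢; exact ⟨hz.1, hz.2.trans hxy⟩, fun h => by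
      have := h (Finset.mem_filter.2 ⟨hx, hxy⟩)
      simp at this⟩
  have hinj : Set.InjOn r S := by
    intro x hx y hy hxy
    rcases lt_trichotomy x y with h | h | h
    · exact absurd hxy (hmono x hx y h).ne
    · exact h
    · exact absurd hxy (hmono y hy x h).ne'
  have himg : S.image r = Finset.range S.card := by
    refine Finset.eq_of_subset_of_card_le ?_ (by simp [Finset.card_image_of_injOn hinj])
    intro i hi
    obtain ⟨x, hx, rfl⟩ := Finset.mem_image.1 hi
    exact Finset.mem_range.2 (Finset.card_lt_card
      ⟨Finset.filter_subset _ _, fun h => by simpa using h hx⟩)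
  have h1 : (S.filter fun x => r x ≤ k).image r = Finset.range (min S.card (k + 1)) := by
    ext i
    have : i ∈ S.image r ↔ i < S.card := by rw [himg, Finset.mem_range]
    simp only [Finset.mem_image, Finset.mem_filter, Finset.mem_range] at this ⊢
    constructor
    · rintro ⟨x, ⟨hx, hk⟩, rfl⟩
      have := this.1 ⟨x, hx, rfl⟩
      omega
    · intro hi
      obtain ⟨x, hx, rfl⟩ := this.2 (by omega)
      exact ⟨x, ⟨hx, by omega⟩, rfl⟩
  rw [← Finset.card_range (min S.card (k + 1)), ← h1, Finset.card_image_of_injOn]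
  exact hinj.mono (Finset.coe_subset.2 (Finset.filter_subset _ _))

namespace CorrelationGraph

open IncompleteCorrelationGraph

variable {V : Type u}

theorem red_adj_iff (G : CorrelationGraph V) {x y : V} :
    G.red.Adj x y ↔ x ≠ y ∧ ¬ G.blue.Adj x y :=
  ⟨fun h => ⟨h.ne, fun hb => G.disjoint x y hb h⟩, fun h => (G.complete x y h.1).resolve_left h.2⟩

/-- `i` and `l` are distinct, not joined by a blue edge, and `j` is a blue neighbour of both. -/
def IsBadTriple (G : CorrelationGraph V) (i j l : V) : Prop :=
  i ≠ l ∧ G.blue.Adj i j ∧ G.blue.Adj j l ∧ ¬ G.blue.Adj i l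

/-- `X` meets each bad triple. -/
def HitsBadTriples (G : CorrelationGraph V) (X : Finset V) : Prop :=
  ∀ i j l, G.IsBadTriple i j l → i ∈ X ∨ j ∈ X ∨ l ∈ X

/-- `x` and `y` are equal or blue neighbours, outside of `X`. -/
def SameClique (G : CorrelationGraph V) (X : Finset V) (x y : V) : Prop :=
  x ∉ X ∧ y ∉ X ∧ (x = y ∨ G.blue.Adj x y)

/-- `v` has a blue neighbour in the clique of `x`. -/
def Touches (G : CorrelationGraph V) (X : Finset V) (v x : V) : Prop :=
  ∃ y, G.SameClique X x y ∧ G.blue.Adj v y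

/-! ### Twin classes and the marking rule -/

section Twins

variable [Fintype V] (G : CorrelationGraph V) (X : Finset V)

open Classical in
/-- The vertices in the clique of `x` which `v` does not distinguish from `x`. -/
noncomputable def twins (v x : V) : Finset V :=
  Finset.univ.filter fun y => G.SameClique X x y ∧ (G.blue.Adj v y ↔ G.blue.Adj v x)

/-- The number of twins of `x` with respect to `v` which precede `x`. -/
noncomputable def rank [LinearOrder V] (v x : V) : ℕ := ((G.twins X v x).filter (· < x)).card

open Classical in
/-- The first blue neighbours of `v` in the cliques outside of `X`. -/
noncomputable def firsts [LinearOrder V] (v : V) : Finset V :=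
  Finset.univ.filter fun x => x ∉ X ∧ G.blue.Adj v x ∧ G.rank X v x = 0

/-- `x` is among the first `k + 1` of its twins, for some vertex of `X` which touches its
clique. -/
def IsMarked [LinearOrder V] (k : ℕ) (x : V) : Prop :=
  x ∉ X ∧ ∃ v ∈ X, G.Touches X v x ∧ G.rank X v x ≤ k

/-- The vertices of the kernel. -/
def IsKept [LinearOrder V] (k : ℕ) (x : V) : Prop := x ∈ X ∨ G.IsMarked X k x

end Twins

variable {G : CorrelationGraph V} {X : Finset V}

theorem SameClique.symm {x y : V} (h : G.SameClique X x y) : G.SameClique X y x :=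
  ⟨h.2.1, h.1, h.2.2.imp Eq.symm SimpleGraph.Adj.symm⟩

/-- If the ends were distinct and not blue neighbours, the three vertices would form a bad triple
avoiding `X`. So the blue components outside `X` are cliques. -/
theorem SameClique.trans (hX : G.HitsBadTriples X) {x y z : V} (h : G.SameClique X x y)
    (h' : G.SameClique X y z) : G.SameClique X x z := by
  obtain ⟨hx, hy, rfl | h⟩ := h
  · exact h'
  obtain ⟨_, hz, rfl | h'⟩ := h'
  · exact ⟨hx, hy, Or.inr h⟩
  refine ⟨hx, hz, ?_⟩
  by_contra hcon
  rw [not_or] at hcon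
  rcases hX x y z ⟨hcon.1, h, h', hcon.2⟩ with h | h | h <;> contradiction

theorem red_adj_of_not_sameClique {x y : V} (hx : x ∉ X) (hy : y ∉ X)
    (h : ¬ G.SameClique X x y) : G.red.Adj x y := by
  rw [red_adj_iff]
  constructor
  · rintro rfl; exact h ⟨hx, hx, Or.inl rfl⟩
  · exact fun hb => h ⟨hx, hy, Or.inr hb⟩

theorem Touches.of_sameClique (hX : G.HitsBadTriples X) {v x y : V} (h : G.Touches X v x)
    (hxy : G.SameClique X x y) : G.Touches X v y := by
  obtain ⟨z, hz, hb⟩ := h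
  exact ⟨z, hxy.symm.trans hX hz, hb⟩

section Marks

variable [Fintype V]

theorem mem_twins {v x y : V} :
    y ∈ G.twins X v x ↔ G.SameClique X x y ∧ (G.blue.Adj v y ↔ G.blue.Adj v x) := by
  simp [twins]

theorem twins_eq (hX : G.HitsBadTriples X) {v x y : V} (h : y ∈ G.twins X v x) :
    G.twins X v y = G.twins X v x := by
  ext z
  rw [mem_twins] at h ⊢
  rw [mem_twins, h.2]
  exact and_congr_left fun _ => ⟨h.1.trans hX, h.1.symm.trans hX⟩

theorem self_mem_twins {v x : V} (hx : x ∉ X) : x ∈ G.twins X v x :=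
  mem_twins.2 ⟨⟨hx, hx, Or.inl rfl⟩, Iff.rfl⟩

variable [LinearOrder V]

theorem card_filter_rank_le (hX : G.HitsBadTriples X) (v x : V) (k : ℕ) :
    ((G.twins X v x).filter fun y => G.rank X v y ≤ k).card =
      min (G.twins X v x).card (k + 1) := by
  rw [← Finset.card_filter_card_filter_lt_le]
  congr 1
  refine Finset.filter_congr fun y hy => ?_
  rw [rank, twins_eq hX hy]

/-- As `u` is not kept, its rank exceeds `k`, so its twin class has `k + 1` members of smaller rank,
all of them kept. If each had two or more clusters, the cost would exceed `k`. -/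
theorem exists_marked_twin (hX : G.HitsBadTriples X) {k : ℕ} {F : V → Finset ℕ} {K : Finset V}
    (hK : ∀ x, x ∈ K ↔ G.IsKept X k x) (hne : ∀ x ∈ K, (F x).Nonempty)
    (hc : ∑ x ∈ K, ((F x).card - 1) ≤ k) {u v : V} (hu : u ∉ K) (hv : v ∈ X)
    (ht : G.Touches X v u) :
    ∃ w ∈ K, G.SameClique X u w ∧ (G.blue.Adj v w ↔ G.blue.Adj v u) ∧ (F w).card = 1 := by
  have huX : u ∉ X := fun h => hu ((hK u).2 (Or.inl h))
  have hrank : k < G.rank X v u := by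
    by_contra! h
    exact hu ((hK u).2 (Or.inr ⟨huX, v, hv, ht, h⟩))
  set S := (G.twins X v u).filter fun y => G.rank X v y ≤ k with hS
  have hcard : S.card = k + 1 := by
    rw [hS, card_filter_rank_le hX]
    have : G.rank X v u ≤ (G.twins X v u).card := Finset.card_filter_le _ _
    omega
  have hSK : S ⊆ K := by
    intro y hy
    rw [hS, Finset.mem_filter, mem_twins] at hy
    exact (hK y).2 (Or.inr ⟨hy.1.1.2.1, v, hv, ht.of_sameClique hX hy.1.1, hy.2⟩)
  obtain ⟨w, hw, hw1⟩ : ∃ w ∈ S, (F w).card = 1 := by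
    by_contra! hcon
    have h1 : ∑ x ∈ S, 1 ≤ ∑ x ∈ S, ((F x).card - 1) := Finset.sum_le_sum fun x hx => by
      have := hcon x hx
      have := (hne x (hSK hx)).card_pos
      omega
    have h2 := Finset.sum_le_sum_of_subset (f := fun x => (F x).card - 1) hSK
    simp only [Finset.sum_const, smul_eq_mul] at h1
    omega
  rw [hS, Finset.mem_filter, mem_twins] at hw
  exact ⟨w, (hK w).2 (Or.inr ⟨hw.1.1.2.1, v, hv, ht.of_sameClique hX hw.1.1, hw.2⟩),
    hw.1.1, hw.1.2, hw1⟩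

/-- Each deleted vertex gets one cluster, that of the unsplit kept vertices of its clique, or a
fresh one if there are none. Single clusters cost nothing. -/
theorem exists_extension (hX : G.HitsBadTriples X) {k : ℕ} {F : V → Finset ℕ} {K : Finset V}
    (hK : ∀ x, x ∈ K ↔ G.IsKept X k x) (hne : ∀ x ∈ K, (F x).Nonempty)
    (hb : ∀ x ∈ K, ∀ y ∈ K, G.blue.Adj x y → (F x ∩ F y).Nonempty)
    (hr : ∀ x ∈ K, ∀ y ∈ K, G.red.Adj x y → 1 < (F x ∪ F y).card)
    (hc : ∑ x ∈ K, ((F x).card - 1) ≤ k) :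
    ∃ F', G.IsOverlappingClustering F' ∧ splitCost F' ≤ k := by
  classical
  have hXK : ∀ x ∉ K, x ∉ X := fun x hx h => hx ((hK x).2 (Or.inl h))
  -- a representative of each clique
  let setoid : Setoid V :=
    { r := fun x y => x = y ∨ G.SameClique X x y
      iseqv := ⟨fun x => Or.inl rfl, fun h => h.imp Eq.symm SameClique.symm, by
        rintro x y z (rfl | h) (rfl | h')
        · exact Or.inl rfl
        · exact Or.inr h'
        · exact Or.inr h
        · exact Or.inr (h.trans hX h')⟩ }
  obtain ⟨g, hg⟩ := Countable.exists_injective_nat (Quotient setoid)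
  have hgiff : ∀ x ∉ X, ∀ y ∉ X, (g ⟦x⟧ = g ⟦y⟧ ↔ G.SameClique X x y) := by
    intro x hx y hy
    rw [hg.eq_iff, Quotient.eq]
    constructor
    · rintro (rfl | h)
      · exact ⟨hx, hx, Or.inl rfl⟩
      · exact h
    · exact fun h => Or.inr h
  -- All clusters in use are below `N`, so `N + q` is unused, and distinct for distinct cliques `q`.
  set N := (K.biUnion F).sup id + 1 with hN
  have hlt : ∀ x ∈ K, ∀ D ∈ F x, D < N := fun x hx D hD =>
    Nat.lt_succ_of_le (Finset.le_sup (f := id) (Finset.mem_biUnion.2 ⟨x, hx, hD⟩))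
  -- a cluster for each clique
  have hD : ∃ D : ℕ → ℕ, ∀ q, (∃ w ∈ K, w ∉ X ∧ g ⟦w⟧ = q ∧ F w = {D q}) ∨
      ((¬ ∃ w ∈ K, w ∉ X ∧ g ⟦w⟧ = q ∧ (F w).card = 1) ∧ D q = N + q) := by
    rw [← Classical.skolem (p := fun q d => (∃ w ∈ K, w ∉ X ∧ g ⟦w⟧ = q ∧ F w = {d}) ∨
      ((¬ ∃ w ∈ K, w ∉ X ∧ g ⟦w⟧ = q ∧ (F w).card = 1) ∧ d = N + q))]
    intro q
    by_cases h : ∃ w ∈ K, w ∉ X ∧ g ⟦w⟧ = q ∧ (F w).card = 1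
    · obtain ⟨w, hw, hwX, hq, h1⟩ := h
      obtain ⟨d, hd⟩ := Finset.card_eq_one.1 h1
      exact ⟨d, Or.inl ⟨w, hw, hwX, hq, hd⟩⟩
    · exact ⟨_, Or.inr ⟨h, rfl⟩⟩
  obtain ⟨D, hD⟩ := hD
  -- Unsplit kept vertices of one clique are blue neighbours and so lie in the same cluster: the
  -- choice of witness behind `D` does not matter.
  have hDeq : ∀ x ∉ X, ∀ w ∈ K, G.SameClique X x w → (F w).card = 1 → F w = {D (g ⟦x⟧)} := by
    intro x hx w hw hxw h1
    have hgw := (hgiff x hx w hxw.2.1).2 hxw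
    rcases hD (g ⟦x⟧) with ⟨w', hw', hwX', hq, hd⟩ | ⟨hcon, _⟩
    · rcases (((hgiff w' hwX' x hx).1 hq).trans hX hxw).2.2 with rfl | hadj
      · exact hd
      · obtain ⟨z, hz⟩ := hb w' hw' w hw hadj
        obtain ⟨e, he⟩ := Finset.card_eq_one.1 h1
        simp only [hd, he, Finset.mem_inter, Finset.mem_singleton] at hz
        rw [he, ← hz.1, ← hz.2]
    · exact absurd ⟨w, hw, hxw.2.1, hgw.symm, h1⟩ hcon
  let F' : V → Finset ℕ := fun x => if x ∈ K then F x else {D (g ⟦x⟧)}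
  have hF1 : ∀ x ∈ K, F' x = F x := fun x hx => if_pos hx
  have hF2 : ∀ x ∉ K, F' x = {D (g ⟦x⟧)} := fun x hx => if_neg hx
  -- the pairs of a removed and a kept vertex
  have hblue : ∀ x ∉ K, ∀ y ∈ K, G.blue.Adj x y → (F' x ∩ F' y).Nonempty := by
    intro x hx y hy hxy
    rw [hF2 x hx, hF1 y hy]
    have hxX := hXK x hx
    by_cases hyX : y ∈ X
    · obtain ⟨w, hw, hs, hcol, h1⟩ := exists_marked_twin hX hK hne hc hx hyX
        ⟨x, ⟨hxX, hxX, Or.inl rfl⟩, hxy.symm⟩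
      rw [← hDeq x hxX w hw hs h1]
      exact hb w hw y hy (hcol.2 hxy.symm).symm
    · have hcl : G.SameClique X x y := ⟨hxX, hyX, Or.inr hxy⟩
      -- Outside `X`, `y` was kept on account of some `v` touching its clique, which is also that of
      -- `x`. So the clique has an unsplit kept vertex; its colour towards `v` plays no role.
      rcases (hK y).1 hy with h | ⟨_, v, hv, ht, _⟩
      · contradiction
      obtain ⟨w, hw, hs, _, h1⟩ := exists_marked_twin hX hK hne hc hx hv
        (ht.of_sameClique hX hcl.symm)
      rw [← hDeq x hxX w hw hs h1]
      rcases (hs.symm.trans hX hcl).2.2 with rfl | hadj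
      · rw [Finset.inter_self]; exact hne _ hw
      · exact hb w hw y hy hadj
  have hred : ∀ x ∉ K, ∀ y ∈ K, G.red.Adj x y → 1 < (F' x ∪ F' y).card := by
    intro x hx y hy hxy
    rw [hF2 x hx, hF1 y hy]
    have hxX := hXK x hx
    have hmain : ∀ w ∈ K, F w = {D (g ⟦x⟧)} → G.red.Adj w y →
        1 < ({D (g ⟦x⟧)} ∪ F y).card := by
      intro w hw h h'
      rw [← h]
      exact hr w hw y hy h'
    have hwit : (¬ ∃ w ∈ K, w ∉ X ∧ g ⟦w⟧ = g ⟦x⟧ ∧ F w = {D (g ⟦x⟧)}) →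
        1 < ({D (g ⟦x⟧)} ∪ F y).card := by
      intro h
      obtain ⟨d, hd⟩ := hne y hy
      refine Finset.one_lt_card.2 ⟨D (g ⟦x⟧), by simp, d, by simp [hd], ?_⟩
      have h2 := ((hD (g ⟦x⟧)).resolve_left h).2
      have := hlt y hy d hd
      omega
    by_cases hyX : y ∈ X
    · by_cases ht : G.Touches X y x
      · obtain ⟨w, hw, hs, hcol, h1⟩ := exists_marked_twin hX hK hne hc hx hyX ht
        refine hmain w hw (hDeq x hxX w hw hs h1) (G.red_adj_iff.2 ⟨?_, fun h => ?_⟩)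
        · rintro rfl; exact hs.2.1 hyX
        · exact (G.red_adj_iff.1 hxy).2 (hcol.1 h.symm).symm
      -- Here `y` is red to the whole clique, so any unsplit kept vertex of it serves as a witness;
      -- without one, the cluster is fresh.
      · by_cases h : ∃ w ∈ K, w ∉ X ∧ g ⟦w⟧ = g ⟦x⟧ ∧ F w = {D (g ⟦x⟧)}
        · obtain ⟨w, hw, hwX, hq, hd⟩ := h
          refine hmain w hw hd (G.red_adj_iff.2 ⟨?_, fun h => ?_⟩)
          · rintro rfl; exact hwX hyX
          · exact ht ⟨w, ((hgiff w hwX x hxX).1 hq).symm, h.symm⟩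
        · exact hwit h
    · by_cases h : ∃ w ∈ K, w ∉ X ∧ g ⟦w⟧ = g ⟦x⟧ ∧ F w = {D (g ⟦x⟧)}
      · obtain ⟨w, hw, hwX, hq, hd⟩ := h
        refine hmain w hw hd (red_adj_of_not_sameClique hwX hyX fun h => ?_)
        rcases (((hgiff w hwX x hxX).1 hq).symm.trans hX h).2.2 with h | h
        · exact hxy.ne h
        · exact (G.red_adj_iff.1 hxy).2 h
      · exact hwit h
  refine ⟨F', ⟨fun x => ?_, fun x y hxy => ?_, fun x y hxy => ?_⟩, ?_⟩
  · by_cases hx : x ∈ K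
    · rw [hF1 x hx]; exact hne x hx
    · rw [hF2 x hx]; simp
  · by_cases hx : x ∈ K <;> by_cases hy : y ∈ K
    · rw [hF1 x hx, hF1 y hy]; exact hb x hx y hy hxy
    · rw [Finset.inter_comm]; exact hblue y hy x hx hxy.symm
    · exact hblue x hx y hy hxy
    · rw [hF2 x hx, hF2 y hy,
        (hgiff x (hXK x hx) y (hXK y hy)).2 ⟨hXK x hx, hXK y hy, Or.inr hxy⟩]
      simp
  · by_cases hx : x ∈ K <;> by_cases hy : y ∈ K
    · rw [hF1 x hx, hF1 y hy]; exact hr x hx y hy hxy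
    · rw [Finset.union_comm]; exact hred y hy x hx hxy.symm
    · exact hred x hx y hy hxy
    · rw [hF2 x hx, hF2 y hy]
      have hxX := hXK x hx
      have hyX := hXK y hy
      have hncl : ¬ G.SameClique X x y := by
        rintro ⟨_, _, h | h⟩
        · exact hxy.ne h
        · exact (G.red_adj_iff.1 hxy).2 h
      have hgne : g ⟦x⟧ ≠ g ⟦y⟧ := fun h => hncl ((hgiff x hxX y hyX).1 h)
      suffices D (g ⟦x⟧) ≠ D (g ⟦y⟧) by
        rw [← Finset.insert_eq, Finset.card_pair this]; exact one_lt_two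
      rcases hD (g ⟦x⟧) with ⟨w, hw, hwX, hq, hd⟩ | ⟨_, hd⟩ <;>
        rcases hD (g ⟦y⟧) with ⟨w', hw', hwX', hq', hd'⟩ | ⟨_, hd'⟩
      · intro he
        have hnw : ¬ G.SameClique X w w' := fun h =>
          hgne (by rw [← hq, ← hq']; exact (hgiff w hwX w' hwX').2 h)
        have := hr w hw w' hw' (red_adj_of_not_sameClique hwX hwX' hnw)
        simp [hd, hd', he] at this
      · have := hlt w hw (D (g ⟦x⟧)) (by simp [hd])
        omega
      · have := hlt w' hw' (D (g ⟦y⟧)) (by simp [hd'])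
        omega
      · omega
  · rw [splitCost, ← Finset.sum_subset (Finset.subset_univ K)]
    · rw [Finset.sum_congr rfl fun x hx => by rw [hF1 x hx]]
      exact hc
    · intro x _ hx
      simp [hF2 x hx]

/-- Deleting the vertices which are not kept yields an equivalent instance. -/
theorem isYesInstance_iff_of_isKept (hX : G.HitsBadTriples X) {k : ℕ} {W : Type u} [Fintype W]
    {G' : CorrelationGraph W} {e : W → V} (he : Function.Injective e)
    (hrange : ∀ x, G.IsKept X k x ↔ ∃ a, e a = x)
    (hadj : ∀ a b, G'.blue.Adj a b ↔ G.blue.Adj (e a) (e b)) :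
    G.IsYesInstance k ↔ G'.IsYesInstance k := by
  classical
  have hadj' : ∀ a b, G'.red.Adj a b ↔ G.red.Adj (e a) (e b) := fun a b => by
    rw [red_adj_iff, red_adj_iff, hadj, he.ne_iff]
  have hsum : ∀ f : V → ℕ, ∑ x ∈ Finset.univ.image e, f x = ∑ a, f (e a) := fun f =>
    Finset.sum_image he.injOn
  rw [isYesInstance_iff, isYesInstance_iff]
  constructor
  · rintro ⟨F, hF, hc⟩
    refine ⟨F ∘ e, ⟨fun a => hF.nonempty _, fun a b h => hF.blue _ _ ((hadj a b).1 h),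
      fun a b h => hF.red _ _ ((hadj' a b).1 h)⟩, le_trans ?_ hc⟩
    exact (hsum fun x => (F x).card - 1).symm.le.trans
      (Finset.sum_le_sum_of_subset (Finset.subset_univ _))
  · rintro ⟨F, hF, hc⟩
    -- The default `∅` off the image of `e` is harmless, as `exists_extension` only looks at `F` on
    -- `K`.
    have hF' : ∀ a, Function.extend e F (fun _ => ∅) (e a) = F a := fun a => he.extend_apply _ _ _
    refine exists_extension hX (K := Finset.univ.image e) (F := Function.extend e F fun _ => ∅)
      (fun x => by simp [hrange]) ?_ ?_ ?_ ?_
    · intro x hx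
      obtain ⟨a, _, rfl⟩ := Finset.mem_image.1 hx
      rw [hF']; exact hF.nonempty a
    · intro x hx y hy hxy
      obtain ⟨a, _, rfl⟩ := Finset.mem_image.1 hx
      obtain ⟨b, _, rfl⟩ := Finset.mem_image.1 hy
      rw [hF', hF']; exact hF.blue a b ((hadj a b).2 hxy)
    · intro x hx y hy hxy
      obtain ⟨a, _, rfl⟩ := Finset.mem_image.1 hx
      obtain ⟨b, _, rfl⟩ := Finset.mem_image.1 hy
      rw [hF', hF']; exact hF.red a b ((hadj' a b).2 hxy)
    · rw [hsum]
      simp only [hF']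
      exact hc

/-! ### Bounds -/

theorem exists_first (hX : G.HitsBadTriples X) {v x : V} (h : G.Touches X v x) :
    ∃ f ∈ G.firsts X v, G.SameClique X x f := by
  classical
  obtain ⟨y, hy, hb⟩ := h
  have hne : (G.twins X v y).Nonempty := ⟨y, self_mem_twins hy.2.1⟩
  set f := (G.twins X v y).min' hne
  have hf : f ∈ G.twins X v y := Finset.min'_mem _ _
  have hf' := mem_twins.1 hf
  refine ⟨f, ?_, hy.trans hX hf'.1⟩
  simp only [firsts, Finset.mem_filter, Finset.mem_univ, true_and]
  refine ⟨hf'.1.2.1, hf'.2.2 hb, ?_⟩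
  rw [rank, twins_eq hX hf, Finset.card_eq_zero, Finset.filter_eq_empty_iff]
  exact fun z hz => not_lt.2 (Finset.min'_le _ _ hz)

/-- A marked vertex lies in the clique of some `f` in `firsts`, among at most `k + 1` blue or at
most `k + 1` red neighbours of `v`. There are at most `3k` choices of `v` and `2k + 1` of `f`. -/
theorem card_le_of_isKept (hX : G.HitsBadTriples X) {k : ℕ} {K : Finset V}
    (hK : ∀ x ∈ K, G.IsKept X k x) (hcard : X.card ≤ 3 * k)
    (hfirsts : ∀ v ∈ X, (G.firsts X v).card ≤ 2 * k + 1) :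
    K.card ≤ 24 * k ^ 3 + 24 * k ^ 2 + 3 * k := by
  classical
  set M : V → V → Finset V := fun v x => (G.twins X v x).filter fun y => G.rank X v y ≤ k
  have hM : ∀ v x, (M v x).card ≤ k + 1 := fun v x => by
    rw [card_filter_rank_le hX]
    exact min_le_right _ _
  -- the vertices in the clique of `f` on which `v` is red
  set R : V → V → Finset V := fun v f =>
    Finset.univ.filter fun y => G.SameClique X f y ∧ ¬ G.blue.Adj v y ∧ G.rank X v y ≤ k
  have hR : ∀ v f, (R v f).card ≤ k + 1 := by
    intro v f
    by_cases h : ∃ y, G.SameClique X f y ∧ ¬ G.blue.Adj v y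
    · obtain ⟨y, hy, hyv⟩ := h
      refine (Finset.card_le_card fun z hz => ?_).trans (hM v y)
      simp only [R, M, Finset.mem_filter, Finset.mem_univ, true_and, mem_twins] at hz ⊢
      exact ⟨⟨hy.symm.trans hX hz.1, iff_of_false hz.2.1 hyv⟩, hz.2.2⟩
    · rw [Finset.card_eq_zero.2]
      · omega
      · exact Finset.filter_eq_empty_iff.2 fun y _ hy => h ⟨y, hy.1, hy.2.1⟩
  have hsub : K ⊆ X ∪ X.biUnion fun v => (G.firsts X v).biUnion fun f => M v f ∪ R v f := by
    intro x hx
    rw [Finset.mem_union]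
    refine (hK x hx).imp id ?_
    rintro ⟨hxX, v, hv, ht, hrank⟩
    obtain ⟨f, hf, hxf⟩ := exists_first hX ht
    simp only [Finset.mem_biUnion, Finset.mem_union]
    refine ⟨v, hv, f, hf, ?_⟩
    simp only [firsts, Finset.mem_filter, Finset.mem_univ, true_and] at hf
    simp only [M, R, Finset.mem_filter, Finset.mem_univ, true_and, mem_twins]
    by_cases hb : G.blue.Adj v x
    · exact Or.inl ⟨⟨hxf.symm, iff_of_true hb hf.2.1⟩, hrank⟩
    · exact Or.inr ⟨hxf.symm, hb, hrank⟩
  have h1 : ∀ v ∈ X, ((G.firsts X v).biUnion fun f => M v f ∪ R v f).card ≤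
      (2 * k + 1) * (2 * k + 2) := fun v hv =>
    (Finset.card_biUnion_le_card_mul _ _ _ fun f _ =>
      (Finset.card_union_le _ _).trans (by have := hM v f; have := hR v f; omega)).trans
      (Nat.mul_le_mul_right _ (hfirsts v hv))
  have h2 := (Finset.card_biUnion_le_card_mul _ _ _ h1).trans (Nat.mul_le_mul_right _ hcard)
  have h3 := (Finset.card_le_card hsub).trans (Finset.card_union_le _ _)
  -- The left side is `12k³ + 18k² + 9k`; the inequality uses `k ≤ k² ≤ k³`.
  have h4 : 3 * k + 3 * k * ((2 * k + 1) * (2 * k + 2)) ≤ 24 * k ^ 3 + 24 * k ^ 2 + 3 * k := by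
    rcases Nat.eq_zero_or_pos k with rfl | hk
    · simp
    · have h5 : k ≤ k ^ 2 := by nlinarith
      have h6 : k ^ 2 ≤ k ^ 3 := by nlinarith
      nlinarith
  omega

/-- These blue neighbours of `v` lie in different cliques, so they are pairwise red. At most `k` of
them are split; the others have distinct single clusters, all in `F v`, and `F v` has at most `k +
1` elements. -/
theorem card_firsts_le {k : ℕ} (h : G.IsYesInstance k) (v : V) :
    (G.firsts X v).card ≤ 2 * k + 1 := by
  classical
  obtain ⟨F, hF, hc⟩ := (G.isYesInstance_iff k).1 h
  set A := G.firsts X v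
  have hA : ∀ x, x ∈ A ↔ x ∉ X ∧ G.blue.Adj v x ∧ G.rank X v x = 0 := by simp [A, firsts]
  set S := A.filter fun x => 1 < (F x).card
  set U := A.filter fun x => ¬ 1 < (F x).card
  have hsum : S.card + U.card = A.card := Finset.card_filter_add_card_filter_not _
  have hS : S.card ≤ k := by
    refine le_trans ?_ hc
    rw [Finset.card_eq_sum_ones]
    refine (Finset.sum_le_sum fun x hx => ?_).trans
      (Finset.sum_le_sum_of_subset (Finset.subset_univ S))
    have := (Finset.mem_filter.1 hx).2
    omega
  have hne : ∀ x ∈ A, ∀ y ∈ A, x < y → ¬ G.SameClique X x y := by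
    intro x hx y hy hxy hs
    have h1 := ((hA y).1 hy).2.2
    rw [rank, Finset.card_eq_zero, Finset.filter_eq_empty_iff] at h1
    exact h1 (mem_twins.2 ⟨hs.symm, iff_of_true ((hA x).1 hx).2.1 ((hA y).1 hy).2.1⟩) hxy
  have hsing : ∀ x ∈ U, ∃ D, F x = {D} := fun x hx => by
    have h1 := (Finset.mem_filter.1 hx).2
    have h2 := (hF.nonempty x).card_pos
    exact Finset.card_eq_one.1 (by omega)
  have hU : U.card ≤ (F v).card := by
    have : ∀ x ∈ U, (F x).min' (hF.nonempty x) ∈ F v := by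
      intro x hx
      obtain ⟨D, hD⟩ := hsing x hx
      obtain ⟨z, hz⟩ := hF.blue v x ((hA x).1 (Finset.mem_filter.1 hx).1).2.1
      simp only [hD, Finset.mem_inter, Finset.mem_singleton] at hz
      simp only [hD, Finset.min'_singleton]
      exact hz.2 ▸ hz.1
    refine Finset.card_le_card_of_injOn _ this ?_
    intro x hx y hy hxy
    have hx := Finset.mem_coe.1 hx
    have hy := Finset.mem_coe.1 hy
    by_contra hcon
    have hxA := (Finset.mem_filter.1 hx).1
    have hyA := (Finset.mem_filter.1 hy).1
    have hns : ¬ G.SameClique X x y := by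
      rcases lt_or_gt_of_ne hcon with h | h
      · exact hne x hxA y hyA h
      · exact fun hs => hne y hyA x hxA h hs.symm
    have hred := hF.red x y (red_adj_of_not_sameClique ((hA x).1 hxA).1 ((hA y).1 hyA).1 hns)
    obtain ⟨D, hD⟩ := hsing x hx
    obtain ⟨E, hE⟩ := hsing y hy
    simp only [hD, hE, Finset.min'_singleton] at hxy
    simp [hD, hE, hxy] at hred
  have hv : (F v).card - 1 ≤ k := (Finset.single_le_sum (f := fun x => (F x).card - 1)
    (fun _ _ => Nat.zero_le _) (Finset.mem_univ v)).trans hc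
  omega

end Marks

/-! ### Disjoint bad triples as a lower bound for the cost -/

/-- Any overlapping clustering splits at least `c` vertices of `X`. -/
def ForcesSplits (G : CorrelationGraph V) (X : Finset V) (c : ℕ) : Prop :=
  ∀ F, G.IsOverlappingClustering F → c ≤ (X.filter fun x => 1 < (F x).card).card

theorem ForcesSplits.le [Fintype V] {c k : ℕ} (h : G.ForcesSplits X c)
    (hG : G.IsYesInstance k) : c ≤ k := by
  obtain ⟨F, hF, hc⟩ := (G.isYesInstance_iff k).1 hG
  refine (h F hF).trans (le_trans ?_ hc)
  rw [Finset.card_eq_sum_ones]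
  refine (Finset.sum_le_sum fun x hx => ?_).trans
    (Finset.sum_le_sum_of_subset (Finset.subset_univ _))
  have := (Finset.mem_filter.1 hx).2
  omega

/-- Three single clusters would agree along the two blue edges, against the red edge `i l`. -/
theorem IsBadTriple.exists_split {i j l : V} (h : G.IsBadTriple i j l) {F : V → Finset ℕ}
    (hF : G.IsOverlappingClustering F) : ∃ x, (x = i ∨ x = j ∨ x = l) ∧ 1 < (F x).card := by
  by_contra! hcon
  have hsing : ∀ x, x = i ∨ x = j ∨ x = l → ∃ D, F x = {D} := fun x hx => by
    have h1 := hcon x hx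
    have h2 := (hF.nonempty x).card_pos
    exact Finset.card_eq_one.1 (by omega)
  obtain ⟨a, ha⟩ := hsing i (by simp)
  obtain ⟨b, hb⟩ := hsing j (by simp)
  obtain ⟨c, hc⟩ := hsing l (by simp)
  obtain ⟨z, hz⟩ := hF.blue i j h.2.1
  obtain ⟨w, hw⟩ := hF.blue j l h.2.2.1
  have hr := hF.red i l (G.red_adj_iff.2 ⟨h.1, h.2.2.2⟩)
  simp only [ha, hb, hc, Finset.mem_inter, Finset.mem_singleton] at hz hw
  obtain rfl : a = c := by omega
  simp [ha, hc] at hr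

theorem IsBadTriple.not_isYesInstance [Fintype V] {i j l : V} (h : G.IsBadTriple i j l) :
    ¬ G.IsYesInstance 0 := by
  intro hG
  obtain ⟨F, hF, hc⟩ := (G.isYesInstance_iff 0).1 hG
  obtain ⟨x, _, hx⟩ := h.exists_split hF
  have := Finset.sum_eq_zero_iff.1 (Nat.le_zero.1 hc) x (Finset.mem_univ x)
  omega

theorem forcesSplits_empty : G.ForcesSplits ∅ 0 := fun _ _ => Nat.zero_le _

/-- The new triple is disjoint from `X`, so its split vertex has not been counted yet. -/
theorem ForcesSplits.insert [DecidableEq V] {c : ℕ} (h : G.ForcesSplits X c) {i j l : V}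
    (ht : G.IsBadTriple i j l) (hi : i ∉ X) (hj : j ∉ X) (hl : l ∉ X) :
    G.ForcesSplits (insert i (insert j (insert l X))) (c + 1) := by
  intro F hF
  obtain ⟨x, hx, hs⟩ := ht.exists_split hF
  have hxX : x ∉ X := by rcases hx with rfl | rfl | rfl <;> assumption
  refine (Nat.succ_le_succ (h F hF)).trans ?_
  rw [Nat.succ_eq_add_one, ← Finset.card_insert_of_notMem (a := x) (by simp [hxX])]
  refine Finset.card_le_card (Finset.insert_subset ?_ ?_)
  · rw [Finset.mem_filter]
    exact ⟨by rcases hx with rfl | rfl | rfl <;> simp, hs⟩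
  · exact Finset.filter_subset_filter _ fun y hy => by simp [hy]

end CorrelationGraph

/-! ### Bounded loop programs -/

namespace RAM

@[simp] theorem State.setReg_reg (s : State) (x w y : ℕ) :
    (s.setReg x w).reg y = if y = x then w else s.reg y := by
  simp [State.setReg, Function.update_apply]

@[simp] theorem State.setReg_arr (s : State) (x w : ℕ) : (s.setReg x w).arr = s.arr := rfl

@[simp] theorem State.setCell_reg (s : State) (a i w : ℕ) : (s.setCell a i w).reg = s.reg := rfl

@[simp] theorem State.setCell_arr (s : State) (a i w b j : ℕ) :
    (s.setCell a i w).arr b j = if b = a ∧ j = i then w else s.arr b j := by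
  by_cases h : b = a
  · subst h; simp [State.setCell, Function.update_apply]
  · simp [State.setCell, h]

/-- Programs in which each loop runs a register through the numbers below the value of
register `0`. -/
inductive LoopProgram where
  | skip
  | assign (x : ℕ) (e : Expr)
  | store (a : ℕ) (i e : Expr)
  | seq (p q : LoopProgram)
  | ite (e : Expr) (p q : LoopProgram)
  | each (x : ℕ) (p : LoopProgram)

namespace LoopProgram

/-- The state after `m` rounds of a loop with the counter `x`. -/
def iterate (f : State → State) (x : ℕ) (s : State) : ℕ → State
  | 0 => s.setReg x 0
  | m + 1 => (f (iterate f x s m)).setReg x (m + 1)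

/-- The state in which a loop program halts. -/
def run : LoopProgram → State → State
  | skip, s => s
  | assign x e, s => s.setReg x (e.eval s)
  | store a i e, s => s.setCell a (i.eval s) (e.eval s)
  | seq p q, s => q.run (p.run s)
  | ite e p q, s => if e.eval s ≠ 0 then p.run s else q.run s
  | each x p, s => iterate p.run x s (s.reg 0)

/-- A compiled loop increments its counter, whereas `iterate` overwrites it with the round number.
The two agree if the body leaves the counter alone, as `IsSafe` demands. -/
def compile : LoopProgram → Program
  | skip => .skip
  | assign x e => .assign x e
  | store a i e => .store a i e
  | seq p q => .seq p.compile q.compile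
  | ite e p q => .ite e p.compile q.compile
  | each x p => .seq (.assign x (.const 0))
      (.loop (.sub (.reg 0) (.reg x)) (.seq p.compile (.assign x (.add (.reg x) (.const 1)))))

/-- The registers to which a program writes. -/
def regs : LoopProgram → List ℕ
  | skip => []
  | assign x _ => [x]
  | store _ _ _ => []
  | seq p q => p.regs ++ q.regs
  | ite _ p q => p.regs ++ q.regs
  | each x p => x :: p.regs

/-- The arrays to which a program writes. -/
def arrs : LoopProgram → List ℕ
  | skip => []
  | assign _ _ => []
  | store a _ _ => [a]
  | seq p q => p.arrs ++ q.arrs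
  | ite _ p q => p.arrs ++ q.arrs
  | each _ p => p.arrs

/-- No loop counter is written to within the loop, and register `0` is never written to. -/
def IsSafe : LoopProgram → Prop
  | skip => True
  | assign x _ => x ≠ 0
  | store _ _ _ => True
  | seq p q => p.IsSafe ∧ q.IsSafe
  | ite _ p q => p.IsSafe ∧ q.IsSafe
  | each x p => x ≠ 0 ∧ x ∉ p.regs ∧ p.IsSafe

theorem run_reg (p : LoopProgram) : ∀ (s : State) (y : ℕ), y ∉ p.regs →
    (p.run s).reg y = s.reg y := by
  induction p with
  | skip => intros; rfl
  | assign x e => intro s y hy; simp_all [run, regs]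
  | store a i e => intros; rfl
  | seq p q ihp ihq =>
    intro s y hy
    simp only [regs, List.mem_append, not_or] at hy
    rw [run, ihq _ _ hy.2, ihp _ _ hy.1]
  | ite e p q ihp ihq =>
    intro s y hy
    simp only [regs, List.mem_append, not_or] at hy
    rw [run]
    split_ifs
    · exact ihp _ _ hy.1
    · exact ihq _ _ hy.2
  | each x p ih =>
    intro s y hy
    simp only [regs, List.mem_cons, not_or] at hy
    rw [run]
    generalize s.reg 0 = m
    induction m with
    | zero => simp [iterate, hy.1]
    | succ m ihm => simpa [iterate, hy.1, ih _ _ hy.2] using ihm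

theorem run_arr (p : LoopProgram) : ∀ (s : State) (a : ℕ), a ∉ p.arrs →
    (p.run s).arr a = s.arr a := by
  induction p with
  | skip => intros; rfl
  | assign x e => intros; rfl
  | store a i e => intro s b hb; ext; simp_all [run, arrs]
  | seq p q ihp ihq =>
    intro s y hy
    simp only [arrs, List.mem_append, not_or] at hy
    rw [run, ihq _ _ hy.2, ihp _ _ hy.1]
  | ite e p q ihp ihq =>
    intro s y hy
    simp only [arrs, List.mem_append, not_or] at hy
    rw [run]
    split_ifs
    · exact ihp _ _ hy.1
    · exact ihq _ _ hy.2
  | each x p ih =>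
    intro s y hy
    rw [run]
    generalize s.reg 0 = m
    induction m with
    | zero => simp [iterate]
    | succ m ihm => simpa [iterate, ih _ _ hy] using ihm

theorem IsSafe.zero_notMem {p : LoopProgram} (h : p.IsSafe) : 0 ∉ p.regs := by
  induction p with
  | skip => simp [regs]
  | assign x e => simpa [regs] using Ne.symm h
  | store a i e => simp [regs]
  | seq p q ihp ihq => simpa [regs] using ⟨ihp h.1, ihq h.2⟩
  | ite e p q ihp ihq => simpa [regs] using ⟨ihp h.1, ihq h.2⟩
  | each x p ih => simpa [regs] using ⟨Ne.symm h.1, ih h.2.2⟩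

theorem iterate_reg_counter (f : State → State) (x : ℕ) (s : State) (m : ℕ) :
    (iterate f x s m).reg x = m := by
  cases m <;> simp [iterate]

theorem iterate_reg {p : LoopProgram} {x y : ℕ} (hx : y ≠ x) (hy : y ∉ p.regs) (s : State)
    (m : ℕ) : (iterate p.run x s m).reg y = s.reg y := by
  induction m with
  | zero => simp [iterate, hx]
  | succ m ih => simp [iterate, hx, run_reg _ _ _ hy, ih]

theorem iterate_arr {p : LoopProgram} {x a : ℕ} (ha : a ∉ p.arrs) (s : State)
    (m : ℕ) : (iterate p.run x s m).arr a = s.arr a := by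
  induction m with
  | zero => rfl
  | succ m ih => simp [iterate, run_arr _ _ _ ha, ih]

/-- A loop program halts in time polynomial in the value of register `0`. -/
theorem exists_run_compile (p : LoopProgram) (hp : p.IsSafe) : ∃ T : Polynomial ℕ, ∀ s : State,
    ∃ t ≤ T.eval (s.reg 0), Run p.compile s t (p.run s) := by
  induction p with
  | skip => exact ⟨1, fun s => ⟨1, by simp, .skip s⟩⟩
  | assign x e => exact ⟨.C (e.cost + 1), fun s => ⟨_, by simp, .assign s x e⟩⟩
  | store a i e => exact ⟨.C (i.cost + e.cost + 1), fun s => ⟨_, by simp, .store s a i e⟩⟩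
  | seq p q ihp ihq =>
    obtain ⟨T, hT⟩ := ihp hp.1
    obtain ⟨T', hT'⟩ := ihq hp.2
    refine ⟨T + T', fun s => ?_⟩
    obtain ⟨t, ht, hr⟩ := hT s
    obtain ⟨t', ht', hr'⟩ := hT' (p.run s)
    rw [run_reg _ _ _ hp.1.zero_notMem] at ht'
    exact ⟨t + t', by rw [Polynomial.eval_add]; omega, .seq hr hr'⟩
  | ite e p q ihp ihq =>
    obtain ⟨T, hT⟩ := ihp hp.1
    obtain ⟨T', hT'⟩ := ihq hp.2
    refine ⟨T + T' + .C (e.cost + 1), fun s => ?_⟩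
    simp only [Polynomial.eval_add, Polynomial.eval_C, run, compile]
    split_ifs with h
    · obtain ⟨t, ht, hr⟩ := hT s
      exact ⟨_, by omega, .ite_true h hr⟩
    · obtain ⟨t, ht, hr⟩ := hT' s
      exact ⟨_, by omega, .ite_false (not_not.1 h) hr⟩
  | each x p ih =>
    obtain ⟨hx, hxp, hp⟩ := hp
    obtain ⟨T, hT⟩ := ih hp
    -- Each round pays 4 for the test and 4 for the increment; the initial assignment costs 2 and
    -- the final test 4.
    refine ⟨.X * (T + .C 8) + .C 6, fun s => ?_⟩
    have key : ∀ d m, m + d = s.reg 0 → ∃ t ≤ d * (T.eval (s.reg 0) + 8) + 4,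
        Run (.loop (.sub (.reg 0) (.reg x))
          (.seq p.compile (.assign x (.add (.reg x) (.const 1)))))
          (iterate p.run x s m) t (iterate p.run x s (s.reg 0)) := by
      intro d
      induction d with
      | zero =>
        rintro m rfl
        refine ⟨4, by simp, .loop_done ?_⟩
        simp [Expr.eval, iterate_reg_counter, iterate_reg (Ne.symm hx) hp.zero_notMem]
      | succ d ihd =>
        intro m hm
        obtain ⟨t, ht, hr⟩ := hT (iterate p.run x s m)
        obtain ⟨t', ht', hr'⟩ := ihd (m + 1) (by omega)
        have h0 : (iterate p.run x s m).reg 0 = s.reg 0 :=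
          iterate_reg (Ne.symm hx) hp.zero_notMem s m
        have hstep := Run.assign (p.run (iterate p.run x s m)) x (.add (.reg x) (.const 1))
        have heval : Expr.eval (p.run (iterate p.run x s m)) (.add (.reg x) (.const 1)) = m + 1 := by
          simp [Expr.eval, run_reg _ _ _ hxp, iterate_reg_counter]
        rw [heval] at hstep
        refine ⟨_, ?_, .loop_step ?_ (.seq hr hstep) hr'⟩
        · rw [h0] at ht
          simp only [Expr.cost]
          rw [Nat.succ_mul]
          omega
        · simp only [Expr.eval, iterate_reg_counter, h0]
          omega
    obtain ⟨t, ht, hr⟩ := key (s.reg 0) 0 (by omega)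
    refine ⟨_, ?_, .seq (.assign s x (.const 0)) hr⟩
    simp only [Expr.cost, Polynomial.eval_add, Polynomial.eval_mul, Polynomial.eval_X,
      Polynomial.eval_C]
    omega

/-- The invariant rule for loops. -/
theorem run_each {p : LoopProgram} {x : ℕ} (I : ℕ → State → Prop) {s : State}
    (h0 : I 0 (s.setReg x 0))
    (hstep : ∀ i < s.reg 0, ∀ σ : State, σ.reg x = i →
      (∀ y, y ≠ x → y ∉ p.regs → σ.reg y = s.reg y) →
      (∀ a, a ∉ p.arrs → σ.arr a = s.arr a) →
      I i σ → I (i + 1) ((p.run σ).setReg x (i + 1))) :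
    I (s.reg 0) ((each x p).run s) := by
  rw [run]
  have : ∀ m ≤ s.reg 0, I m (iterate p.run x s m) := by
    intro m
    induction m with
    | zero => exact fun _ => h0
    | succ m ih =>
      exact fun hm => hstep m (by omega) _ (iterate_reg_counter _ _ _ _)
        (fun y hy hy' => iterate_reg hy hy' s m) (fun a ha => iterate_arr ha s m) (ih (by omega))
  exact this _ le_rfl

end LoopProgram

end RAM

/-! ### Loading the graph -/

namespace RAM

namespace LoopProgram

/-- Run `p` if the value of `e` is not `0`. -/
def onlyIf (e : Expr) (p : LoopProgram) : LoopProgram := ite e p skip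

/-- Run `p` if the value of `e` is `0`. -/
def ifZero (e : Expr) (p : LoopProgram) : LoopProgram := ite e skip p

theorem run_seq (p q : LoopProgram) (s : State) : (seq p q).run s = q.run (p.run s) := rfl

theorem run_assign (x : ℕ) (e : Expr) (s : State) :
    (assign x e).run s = s.setReg x (e.eval s) := rfl

theorem run_store (a : ℕ) (i e : Expr) (s : State) :
    (store a i e).run s = s.setCell a (i.eval s) (e.eval s) := rfl

theorem run_onlyIf (e : Expr) (p : LoopProgram) (s : State) :
    (onlyIf e p).run s = if e.eval s ≠ 0 then p.run s else s := rfl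

theorem run_ifZero (e : Expr) (p : LoopProgram) (s : State) :
    (ifZero e p).run s = if e.eval s = 0 then p.run s else s := by
  by_cases h : e.eval s = 0 <;> simp [ifZero, run, h]

/-- A rule for loops whose rounds establish stable properties. -/
theorem run_each_forall {p : LoopProgram} {x : ℕ} (J : State → Prop) (R : State → State → Prop)
    (Q : ℕ → State → Prop) {s : State} {n : ℕ}
    (hn : s.reg 0 = n) (htrans : ∀ σ τ υ, R σ τ → R τ υ → R σ υ) (hQ : ∀ i σ τ, R σ τ → Q i σ → Q i τ)
    (hR : ∀ σ m, R σ (σ.setReg x m)) (hJ : ∀ σ m, J σ → J (σ.setReg x m)) (h0 : J s)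
    (hstep : ∀ i < n, ∀ σ : State, σ.reg x = i →
      (∀ y, y ≠ x → y ∉ p.regs → σ.reg y = s.reg y) → J σ →
      J (p.run σ) ∧ R σ (p.run σ) ∧ Q i (p.run σ)) :
    J ((each x p).run s) ∧ R s ((each x p).run s) ∧ ∀ i < n, Q i ((each x p).run s) := by
  subst hn
  refine run_each (fun m σ => J σ ∧ R s σ ∧ ∀ i < m, Q i σ)
    ⟨hJ _ _ h0, hR _ _, by simp⟩ ?_
  rintro i hi σ hx hreg - ⟨h1, h2, h3⟩
  obtain ⟨h1', h2', h3'⟩ := hstep i hi σ hx hreg h1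
  refine ⟨hJ _ _ h1', htrans _ _ _ (htrans _ _ _ h2 h2') (hR _ _), fun j hj => ?_⟩
  refine hQ _ _ _ (hR _ _) ?_
  rcases Nat.lt_succ_iff_lt_or_eq.1 hj with h | rfl
  · exact hQ _ _ _ h2' (h3 j h)
  · exact h3'

end LoopProgram

open LoopProgram

/-- The row offsets are in array `1` and the blue adjacency matrix of `G` in array `4`. -/
structure HasMatrix {n : ℕ} (G : CorrelationGraph (Fin n)) (k : ℕ) (s : State) : Prop where
  reg_zero : s.reg 0 = n
  reg_one : s.reg 1 = k
  offset : ∀ i < n, s.arr 1 i = i * n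
  matrix : ∀ i j : Fin n, s.arr 4 (i * n + j) = blueEntry G i j

theorem blueEntry_ne_zero {n : ℕ} {G : CorrelationGraph (Fin n)} {i j : Fin n} :
    blueEntry G i j ≠ 0 ↔ G.blue.Adj i j := by
  simp [blueEntry]

/-- The entry of the blue adjacency matrix for the vertices in the registers `x` and `y`. -/
def blueExpr (x y : ℕ) : Expr := .load 4 (.add (.load 1 (.reg x)) (.reg y))

/-- The distance of the values of two expressions. -/
def distExpr (e e' : Expr) : Expr := .add (.sub e e') (.sub e' e)

theorem eval_distExpr {e e' : Expr} {s : State} :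
    (distExpr e e').eval s = 0 ↔ e.eval s = e'.eval s := by
  simp only [distExpr, Expr.eval]
  omega

section

variable {n : ℕ} {G : CorrelationGraph (Fin n)} {k : ℕ} {s : State}

theorem HasMatrix.of_eq {s' : State} (h : HasMatrix G k s) (h0 : s'.reg 0 = s.reg 0)
    (h1 : s'.reg 1 = s.reg 1) (h2 : s'.arr 1 = s.arr 1) (h3 : s'.arr 4 = s.arr 4) :
    HasMatrix G k s' :=
  ⟨h0.trans h.reg_zero, h1.trans h.reg_one, by rw [h2]; exact h.offset,
    by rw [h3]; exact h.matrix⟩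

theorem HasMatrix.run (h : HasMatrix G k s) {p : LoopProgram} (h0 : 0 ∉ p.regs) (h1 : 1 ∉ p.regs)
    (h2 : 1 ∉ p.arrs) (h3 : 4 ∉ p.arrs) : HasMatrix G k (p.run s) :=
  h.of_eq (run_reg _ _ _ h0) (run_reg _ _ _ h1) (run_arr _ _ _ h2) (run_arr _ _ _ h3)

theorem HasMatrix.eval_blueExpr (h : HasMatrix G k s) {x y : ℕ} {i j : Fin n} (hx : s.reg x = i)
    (hy : s.reg y = j) : (blueExpr x y).eval s = blueEntry G i j := by
  simp [blueExpr, Expr.eval, hx, hy, h.offset, h.matrix]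

/-- Write the row offsets to array `1` and copy array `0` to array `4`. -/
def loadMatrix : LoopProgram :=
  .each 2 (.seq (.store 1 (.reg 2) (.reg 5)) (.seq
    (.each 3 (.store 4 (.add (.reg 5) (.reg 3)) (.load 0 (.add (.reg 5) (.reg 3)))))
    (.assign 5 (.add (.reg 5) (.reg 0)))))

/-- The machine cannot multiply, so register `5` accumulates the offset `i * n` by additions. The
matrix is copied because the output will overwrite array `0`. -/
theorem hasMatrix_loadMatrix (h : IsInitial s G k) : HasMatrix G k (loadMatrix.run s) := by
  have key : (loadMatrix.run s).reg 5 = s.reg 0 * n ∧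
      (∀ i < s.reg 0, (loadMatrix.run s).arr 1 i = i * n) ∧
      ∀ a < s.reg 0 * n, (loadMatrix.run s).arr 4 a = s.arr 0 a := by
    refine run_each (fun m σ => σ.reg 5 = m * n ∧ (∀ i < m, σ.arr 1 i = i * n) ∧
      ∀ a < m * n, σ.arr 4 a = s.arr 0 a) ?_ ?_
    · simp [h.reg_rest]
    · rintro i hi σ hx hreg harr ⟨h1, h2, h3⟩
      have hσ0 : σ.reg 0 = n := (hreg 0 (by decide) (by decide)).trans h.reg_zero
      have harr0 : σ.arr 0 = s.arr 0 := harr 0 (by decide)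
      simp only [run_seq, run_assign, run_store, Expr.eval, hx, h1]
      set τ := σ.setCell 1 i (i * n) with hτ
      have hin := run_each (x := 3)
        (p := .store 4 (.add (.reg 5) (.reg 3)) (.load 0 (.add (.reg 5) (.reg 3)))) (s := τ)
        (fun m υ => ∀ a < i * n + m, υ.arr 4 a = s.arr 0 a) (by simpa [hτ] using h3) (by
          intro j hj υ hx' hreg' harr' hυ a ha
          have h5 : υ.reg 5 = i * n := by rw [hreg' 5 (by decide) (by decide)]; simp [hτ, h1]
          have h6 : υ.arr 0 = s.arr 0 := by rw [harr' 0 (by decide), ← harr0]; ext; simp [hτ]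
          simp only [run_store, Expr.eval, h5, hx', h6, State.setReg_arr, State.setCell_arr,
            true_and]
          split_ifs with hcase
          · rw [hcase]
          · exact hυ a (by omega))
      set υ := (each 3 (.store 4 (.add (.reg 5) (.reg 3))
        (.load 0 (.add (.reg 5) (.reg 3))))).run τ with hυ
      have hτ0 : τ.reg 0 = n := by simpa [hτ] using hσ0
      have e5 : υ.reg 5 = i * n := by
        rw [hυ, run_reg _ _ _ (by decide)]; simp [hτ, h1]
      have e0 : υ.reg 0 = n := by
        rw [hυ, run_reg _ _ _ (by decide), hτ0]
      have e1 : υ.arr 1 = τ.arr 1 := run_arr _ _ _ (by decide)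
      rw [hτ0] at hin
      simp only [State.setReg_reg, State.setReg_arr, e5, e0, e1, hτ, State.setCell_arr, true_and]
      refine ⟨by simp [Nat.succ_mul], fun i' hi' => ?_, fun a ha => hin a ?_⟩
      · split_ifs with hcase
        · rw [hcase]
        · exact h2 i' (by omega)
      · rwa [Nat.succ_mul] at ha
  rw [h.reg_zero] at key
  refine ⟨?_, ?_, key.2.1, fun i j => ?_⟩
  · rw [run_reg _ _ _ (by decide), h.reg_zero]
  · rw [run_reg _ _ _ (by decide), h.reg_one]
  · rw [key.2.2, h.matrix]
    calc (i : ℕ) * n + j < i * n + n := by omega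
      _ = (i + 1) * n := (Nat.succ_mul _ _).symm
      _ ≤ n * n := Nat.mul_le_mul_right _ i.2

/-! ### Packing bad triples -/

/-- The nonzero cells of `f` are those with index in `X`. -/
def IsIndicator (f : ℕ → ℕ) (X : Finset (Fin n)) : Prop := ∀ i : Fin n, f i ≠ 0 ↔ i ∈ X

def packBody : LoopProgram :=
  .onlyIf (blueExpr 2 3) <| .onlyIf (blueExpr 3 4) <| .ifZero (blueExpr 2 4) <|
  .onlyIf (distExpr (.reg 2) (.reg 4)) <| .ifZero (.load 2 (.reg 2)) <|
  .ifZero (.load 2 (.reg 3)) <| .ifZero (.load 2 (.reg 4)) <|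
  .seq (.store 2 (.reg 2) (.const 1)) <| .seq (.store 2 (.reg 3) (.const 1)) <|
  .seq (.store 2 (.reg 4) (.const 1)) <| .assign 6 (.add (.reg 6) (.const 1))

/-- Greedily collect disjoint bad triples in array `2` and count them in register `6`. -/
def pack : LoopProgram := .each 2 (.each 3 (.each 4 packBody))

theorem run_packBody (h : HasMatrix G k s) {i j l : Fin n} (hi : s.reg 2 = i) (hj : s.reg 3 = j)
    (hl : s.reg 4 = l) :
    (G.IsBadTriple i j l ∧ s.arr 2 i = 0 ∧ s.arr 2 j = 0 ∧ s.arr 2 l = 0 ∧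
      packBody.run s = (((s.setCell 2 i 1).setCell 2 j 1).setCell 2 l 1).setReg 6 (s.reg 6 + 1)) ∨
    (¬ (G.IsBadTriple i j l ∧ s.arr 2 i = 0 ∧ s.arr 2 j = 0 ∧ s.arr 2 l = 0) ∧
      packBody.run s = s) := by
  simp only [packBody, run_onlyIf, run_ifZero, h.eval_blueExpr hi hj, h.eval_blueExpr hj hl,
    h.eval_blueExpr hi hl, ne_eq, eval_distExpr, Expr.eval, hi, hj, hl, run_seq, run_store,
    run_assign, State.setCell_reg, CorrelationGraph.IsBadTriple, ← blueEntry_ne_zero,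
    Fin.val_inj, not_not]
  split_ifs <;> simp_all

/-- What packing preserves. -/
structure IsPacking (G : CorrelationGraph (Fin n)) (k : ℕ) (s : State) : Prop where
  hasMatrix : HasMatrix G k s
  exists_indicator : ∃ X, IsIndicator (s.arr 2) X ∧ G.ForcesSplits X (s.reg 6) ∧
    X.card ≤ 3 * s.reg 6

theorem IsPacking.setReg (h : IsPacking G k s) {x : ℕ} (hx : x ≠ 0) (hx1 : x ≠ 1) (hx6 : x ≠ 6)
    (m : ℕ) : IsPacking G k (s.setReg x m) := by
  refine ⟨h.hasMatrix.of_eq ?_ ?_ rfl rfl, ?_⟩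
  · simp [hx.symm]
  · simp [hx1.symm]
  · simpa [hx6.symm] using h.exists_indicator

/-- The set in array `2` of `s'` contains the one in array `2` of `s`. -/
def Grows (s s' : State) : Prop := ∀ a, s.arr 2 a ≠ 0 → s'.arr 2 a ≠ 0

/-- The set in array `2` meets the triple, if it is bad. -/
def Meets (G : CorrelationGraph (Fin n)) (i j l : ℕ) (s : State) : Prop :=
  ∀ i' j' l' : Fin n, i = i' → j = j' → l = l' → G.IsBadTriple i' j' l' →
    s.arr 2 i ≠ 0 ∨ s.arr 2 j ≠ 0 ∨ s.arr 2 l ≠ 0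

theorem Meets.of_grows {i j l : ℕ} {s s' : State} (hs : Grows s s') (h : Meets G i j l s) :
    Meets G i j l s' := fun i' j' l' hi hj hl hb =>
  (h i' j' l' hi hj hl hb).imp (hs i) (Or.imp (hs j) (hs l))

theorem packBody_spec (h : IsPacking G k s) {i j l : ℕ} (hin : i < n) (hjn : j < n) (hln : l < n)
    (hi : s.reg 2 = i) (hj : s.reg 3 = j) (hl : s.reg 4 = l) :
    IsPacking G k (packBody.run s) ∧ Grows s (packBody.run s) ∧
      Meets G i j l (packBody.run s) := by
  obtain ⟨X, hX, hf, hc⟩ := h.exists_indicator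
  rcases run_packBody h.hasMatrix (i := ⟨i, hin⟩) (j := ⟨j, hjn⟩) (l := ⟨l, hln⟩) hi hj hl with
    ⟨hb, h1, h2, h3, hrun⟩ | ⟨hnot, hrun⟩
  · refine ⟨⟨h.hasMatrix.run (by decide) (by decide) (by decide) (by decide),
      insert ⟨i, hin⟩ (insert ⟨j, hjn⟩ (insert ⟨l, hln⟩ X)), ?_, ?_, ?_⟩, ?_, ?_⟩
    · intro a
      have := hX a
      simp only [hrun, State.setReg_arr, State.setCell_arr, Finset.mem_insert, Fin.ext_iff,
        true_and]
      split_ifs <;> simp_all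
    · rw [hrun]
      simp only [State.setReg_reg, if_true]
      exact hf.insert hb (fun hm => (hX _).2 hm h1) (fun hm => (hX _).2 hm h2)
        (fun hm => (hX _).2 hm h3)
    · rw [hrun]
      simp only [State.setReg_reg, if_true]
      have := Finset.card_insert_le (⟨i, hin⟩ : Fin n) (insert ⟨j, hjn⟩ (insert ⟨l, hln⟩ X))
      have := Finset.card_insert_le (⟨j, hjn⟩ : Fin n) (insert ⟨l, hln⟩ X)
      have := Finset.card_insert_le (⟨l, hln⟩ : Fin n) X
      omega
    · intro a ha
      rw [hrun]
      simp only [State.setReg_arr, State.setCell_arr, true_and]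
      split_ifs <;> simp_all
    · intro _ _ _ _ _ _ _
      right; right
      simp [hrun]
  · rw [hrun]
    refine ⟨h, fun _ ha => ha, ?_⟩
    rintro i' j' l' rfl rfl rfl hb
    by_contra! hcon
    exact hnot ⟨hb, hcon.1, hcon.2.1, hcon.2.2⟩

/-- One pass suffices for maximality: a bad triple is met right after its inspection, and the
collected set only grows. -/
theorem pack_spec (h : IsPacking G k s) : ∃ X, G.HitsBadTriples X ∧
    IsIndicator ((pack.run s).arr 2) X ∧ G.ForcesSplits X ((pack.run s).reg 6) ∧
      X.card ≤ 3 * (pack.run s).reg 6 := by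
  have htrans : ∀ σ τ υ, Grows σ τ → Grows τ υ → Grows σ υ := fun _ _ _ h h' a => h' a ∘ h a
  have key : IsPacking G k (pack.run s) ∧ Grows s (pack.run s) ∧
      ∀ i < n, ∀ j < n, ∀ l < n, Meets G i j l (pack.run s) := by
    refine run_each_forall (x := 2) (IsPacking G k) Grows
      (fun i σ => ∀ j < n, ∀ l < n, Meets G i j l σ) h.hasMatrix.reg_zero htrans
      (fun i σ τ hs hm j hj l hl => (hm j hj l hl).of_grows hs) (fun _ _ _ => id)
      (fun σ m hσ => hσ.setReg (by decide) (by decide) (by decide) m) h ?_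
    intro i hi σ hx _ hσ
    refine run_each_forall (x := 3) (IsPacking G k) Grows
      (fun j σ' => ∀ l < n, Meets G i j l σ') hσ.hasMatrix.reg_zero htrans
      (fun j _ _ hs hm l hl => (hm l hl).of_grows hs) (fun _ _ _ => id)
      (fun _ m hσ => hσ.setReg (by decide) (by decide) (by decide) m) hσ ?_
    intro j hj τ hx' hreg' hτ
    refine run_each_forall (x := 4) (IsPacking G k) Grows
      (fun l => Meets G i j l) hτ.hasMatrix.reg_zero htrans
      (fun l _ _ hs hm => hm.of_grows hs) (fun _ _ _ => id)
      (fun _ m hσ => hσ.setReg (by decide) (by decide) (by decide) m) hτ ?_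
    intro l hl υ hx'' hreg'' hυ
    refine packBody_spec hυ hi hj hl ?_ ?_ hx''
    · rw [hreg'' 2 (by decide) (by decide), hreg' 2 (by decide) (by decide), hx]
    · rw [hreg'' 3 (by decide) (by decide), hx']
  obtain ⟨⟨_, X, hX, hf, hc⟩, _, hm⟩ := key
  refine ⟨X, fun i j l hb => ?_, hX, hf, hc⟩
  rw [← hX, ← hX, ← hX]
  exact hm i i.2 j j.2 l l.2 i j l rfl rfl rfl hb

end

end RAM

/-! ### Marking -/

theorem Finset.card_filter_val_lt_succ {n : ℕ} (S : Finset (Fin n)) (i : Fin n) :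
    (S.filter fun x => x.val < i.val + 1).card =
      (S.filter fun x => x.val < i.val).card + if i ∈ S then 1 else 0 := by
  split_ifs with h
  · rw [← Finset.card_insert_of_notMem (a := i) (by simp)]
    congr 1
    ext x
    simp only [Finset.mem_filter, Finset.mem_insert, Fin.ext_iff, Nat.lt_succ_iff_lt_or_eq]
    constructor
    · rintro ⟨h1, h2 | h2⟩
      · exact Or.inr ⟨h1, h2⟩
      · exact Or.inl h2
    · rintro (h1 | h1)
      · exact ⟨(Fin.ext h1) ▸ h, Or.inr h1⟩
      · exact ⟨h1.1, Or.inl h1.2⟩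
  · rw [add_zero]
    congr 1
    refine Finset.filter_congr fun x hx => ?_
    have : x.val ≠ i.val := fun he => h (Fin.ext he ▸ hx)
    omega

namespace RAM

open LoopProgram

variable {n : ℕ} {G : CorrelationGraph (Fin n)} {k : ℕ} {s : State} {X : Finset (Fin n)}

theorem IsIndicator.eq_zero_iff {f : ℕ → ℕ} (h : IsIndicator f X) (i : Fin n) :
    f i = 0 ↔ i ∉ X := by
  rw [← h i, not_not]

/-- By truncation, `1 - |u - w|` is nonzero only for `u = w`, and the sum acts as a disjunction: the
test holds if `w` equals `u` or is its blue neighbour. -/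
def scanBody : LoopProgram :=
  .ifZero (.load 2 (.reg 4)) <|
  .onlyIf (.add (.sub (.const 1) (distExpr (.reg 3) (.reg 4))) (blueExpr 3 4)) <|
  .seq (.onlyIf (blueExpr 2 4) (.assign 9 (.const 1))) <|
  .onlyIf (.sub (.reg 3) (.reg 4)) <| .ifZero (distExpr (blueExpr 2 4) (blueExpr 2 3)) <|
  .assign 8 (.add (.reg 8) (.const 1))

/-- For the vertices `v` and `u` in the registers `2` and `3`, compute the rank of `u` in register
`8`, and in register `9` whether `v` touches the clique of `u`. -/
def scan : LoopProgram :=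
  .seq (.assign 8 (.const 0)) <| .seq (.assign 9 (.const 0)) <| .each 4 scanBody

open Classical in
theorem scanBody_spec (h : HasMatrix G k s) (hX : IsIndicator (s.arr 2) X) {v u w : Fin n}
    (hv : s.reg 2 = v) (hu : s.reg 3 = u) (hw : s.reg 4 = w) (huX : u ∉ X) :
    (scanBody.run s).reg 8 = s.reg 8 + (if w ∈ (G.twins X v u).filter (· < u) then 1 else 0) ∧
      ((scanBody.run s).reg 9 ≠ 0 ↔ s.reg 9 ≠ 0 ∨ G.SameClique X u w ∧ G.blue.Adj v w) := by
  have hh : ∀ m, HasMatrix G k (s.setReg 9 m) := fun m => h.of_eq (by simp) (by simp) rfl rfl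
  have hcol : blueEntry G v w = blueEntry G v u ↔ (G.blue.Adj v w ↔ G.blue.Adj v u) := by
    unfold blueEntry
    by_cases h1 : G.blue.Adj v w <;> by_cases h2 : G.blue.Adj v u <;> simp [h1, h2]
  have hlt : (u : ℕ) - w ≠ 0 ↔ w < u := by rw [Fin.lt_def]; omega
  have hlt' : (u : ℕ) - w = 0 ↔ ¬ w < u := by rw [Fin.lt_def]; omega
  have e9 : ∀ m, (blueExpr 2 4).eval (s.setReg 9 m) = blueEntry G v w := fun m =>
    (hh m).eval_blueExpr (by simpa using hv) (by simpa using hw)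
  have e9' : ∀ m, (blueExpr 2 3).eval (s.setReg 9 m) = blueEntry G v u := fun m =>
    (hh m).eval_blueExpr (by simpa using hv) (by simpa using hu)
  have hdist : (distExpr (.reg 3) (.reg 4)).eval s = 0 ↔ u = w := by
    rw [eval_distExpr, Expr.eval, Expr.eval, hu, hw, Fin.val_inj]
  have hcl : w ∉ X → (1 - (distExpr (.reg 3) (.reg 4)).eval s + blueEntry G u w ≠ 0 ↔
      G.SameClique X u w) := by
    intro hwX
    have h1 := blueEntry_ne_zero (G := G) (i := u) (j := w)
    have h2 : 1 - (distExpr (.reg 3) (.reg 4)).eval s + blueEntry G u w ≠ 0 ↔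
        (distExpr (.reg 3) (.reg 4)).eval s = 0 ∨ blueEntry G u w ≠ 0 := by omega
    rw [h2, hdist, h1]
    simp [CorrelationGraph.SameClique, huX, hwX]
  simp only [scanBody, run_ifZero, run_onlyIf, run_seq, run_assign, Expr.eval, hw,
    hX.eq_zero_iff, h.eval_blueExpr hu hw, h.eval_blueExpr hv hw, blueEntry_ne_zero]
  by_cases hwX : w ∈ X
  · have : ¬ G.SameClique X u w := fun hs => hs.2.1 hwX
    simp [hwX, CorrelationGraph.mem_twins, this]
  simp only [hwX, not_false_eq_true, if_true, hcl hwX, Finset.mem_filter,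
    CorrelationGraph.mem_twins]
  by_cases hs : G.SameClique X u w
  · simp only [hs, if_true, true_and]
    by_cases hb : G.blue.Adj v w
    · simp only [hb, if_true, State.setReg_reg, hu, hw, eval_distExpr, e9, e9', hcol]
      by_cases h1 : w < u <;> by_cases h2 : G.blue.Adj v u <;> simp [h1, h2, hlt']
    · simp only [hb, if_false, hu, hw, eval_distExpr, h.eval_blueExpr hv hw,
        h.eval_blueExpr hv hu, hcol, hlt]
      by_cases h1 : w < u <;> by_cases h2 : G.blue.Adj v u <;> simp [h1, h2]
  · simp [hs]

theorem scan_spec (h : HasMatrix G k s) (hX : IsIndicator (s.arr 2) X) {v u : Fin n}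
    (hv : s.reg 2 = v) (hu : s.reg 3 = u) (huX : u ∉ X) :
    (scan.run s).reg 8 = G.rank X v u ∧ ((scan.run s).reg 9 ≠ 0 ↔ G.Touches X v u) := by
  classical
  simp only [scan, run_seq, run_assign, Expr.eval]
  set τ := (s.setReg 8 0).setReg 9 0 with hτ
  have hτ0 : τ.reg 0 = n := by simp [hτ, h.reg_zero]
  have key := run_each (p := scanBody) (x := 4) (s := τ) (fun m σ =>
    σ.reg 8 = (((G.twins X v u).filter (· < u)).filter fun x => x.val < m).card ∧
      (σ.reg 9 ≠ 0 ↔ ∃ w : Fin n, w.val < m ∧ G.SameClique X u w ∧ G.blue.Adj v w))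
    (by simp [hτ]) (by
      rintro i hi σ hx hreg harr ⟨h1, h2⟩
      rw [hτ0] at hi
      obtain ⟨h3, h4⟩ := scanBody_spec (s := σ) (w := ⟨i, hi⟩)
        (h.of_eq (by rw [hreg 0 (by decide) (by decide)]; simp [hτ])
          (by rw [hreg 1 (by decide) (by decide)]; simp [hτ])
          (by rw [harr 1 (by decide)]; simp [hτ]) (by rw [harr 4 (by decide)]; simp [hτ]))
        (by rw [harr 2 (by decide)]; simpa [hτ] using hX)
        (by rw [hreg 2 (by decide) (by decide)]; simpa [hτ] using hv)
        (by rw [hreg 3 (by decide) (by decide)]; simpa [hτ] using hu) hx huX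
      have h5 := Finset.card_filter_val_lt_succ ((G.twins X v u).filter (· < u)) ⟨i, hi⟩
      simp only at h5
      constructor
      · simp only [State.setReg_reg, h3, h1, h5]
        simp
      · simp only [State.setReg_reg]
        rw [if_neg (by decide), h4, h2]
        constructor
        · rintro (⟨w, hw, hs⟩ | hs)
          · exact ⟨w, by omega, hs⟩
          · exact ⟨_, Nat.lt_succ_self i, hs⟩
        · rintro ⟨w, hw, hs⟩
          rcases Nat.lt_succ_iff_lt_or_eq.1 hw with hlt | rfl
          · exact Or.inl ⟨w, hlt, hs⟩
          · exact Or.inr hs)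
  rw [hτ0] at key
  refine ⟨?_, ?_⟩
  · rw [key.1, CorrelationGraph.rank]
    congr 1
    exact Finset.filter_true_of_mem fun x _ => x.2
  · rw [key.2]
    simp [CorrelationGraph.Touches]

/-- By truncation, `(k + 1) - rank` is nonzero exactly when the rank is at most `k`. Register `7`
counts the elements of `firsts`. -/
def markBody : LoopProgram :=
  .ifZero (.load 2 (.reg 3)) <| .seq scan <|
  .seq (.onlyIf (.reg 9) <| .onlyIf (.sub (.add (.reg 1) (.const 1)) (.reg 8)) <|
    .store 3 (.reg 3) (.const 1)) <|
  .onlyIf (blueExpr 2 3) <| .ifZero (.reg 8) <| .assign 7 (.add (.reg 7) (.const 1))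

/-- Mark vertices in array `3` for the vertex in register `2`, and set register `10` if this
vertex has too many blue neighbours. -/
def markFor : LoopProgram :=
  .onlyIf (.load 2 (.reg 2)) <| .seq (.assign 7 (.const 0)) <| .seq (.each 3 markBody) <|
  .onlyIf (.sub (.reg 7) (.add (.add (.reg 1) (.reg 1)) (.const 1))) (.assign 10 (.const 1))

def mark : LoopProgram := .each 2 markFor

theorem mem_firsts {v u : Fin n} :
    u ∈ G.firsts X v ↔ u ∉ X ∧ G.blue.Adj v u ∧ G.rank X v u = 0 := by
  simp [CorrelationGraph.firsts]

open Classical in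
theorem markBody_spec (h : HasMatrix G k s) (hX : IsIndicator (s.arr 2) X) {v u : Fin n}
    (hv : s.reg 2 = v) (hu : s.reg 3 = u) :
    (markBody.run s).reg 7 = s.reg 7 + (if u ∈ G.firsts X v then 1 else 0) ∧
      ∀ a, (markBody.run s).arr 3 a ≠ 0 ↔
        s.arr 3 a ≠ 0 ∨ a = u ∧ u ∉ X ∧ G.Touches X v u ∧ G.rank X v u ≤ k := by
  rw [markBody, run_ifZero]
  simp only [Expr.eval, hu, hX.eq_zero_iff]
  by_cases huX : u ∈ X
  · simp [huX, mem_firsts]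
  obtain ⟨h8, h9⟩ := scan_spec h hX hv hu huX
  have hm : HasMatrix G k (scan.run s) := h.run (by decide) (by decide) (by decide) (by decide)
  have h1 : (scan.run s).reg 1 = k := hm.reg_one
  have h2 : (scan.run s).reg 2 = v := by rw [run_reg _ _ _ (by decide), hv]
  have h3 : (scan.run s).reg 3 = u := by rw [run_reg _ _ _ (by decide), hu]
  have h7 : (scan.run s).reg 7 = s.reg 7 := run_reg _ _ _ (by decide)
  have ha : (scan.run s).arr 3 = s.arr 3 := run_arr _ _ _ (by decide)
  have hk : k + 1 - G.rank X v u ≠ 0 ↔ G.rank X v u ≤ k := by omega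
  simp only [huX, not_false_eq_true, if_true, run_seq]
  set σ := scan.run s
  set τ := (onlyIf (.reg 9) <| .onlyIf (.sub (.add (.reg 1) (.const 1)) (.reg 8)) <|
    .store 3 (.reg 3) (.const 1)).run σ with hτ
  have hmτ : HasMatrix G k τ := hm.run (by decide) (by decide) (by decide) (by decide)
  have hregτ : ∀ y, τ.reg y = σ.reg y := fun y => run_reg _ _ _ (by simp [onlyIf, regs])
  have harr : ∀ a, τ.arr 3 a ≠ 0 ↔
      s.arr 3 a ≠ 0 ∨ a = u ∧ G.Touches X v u ∧ G.rank X v u ≤ k := by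
    intro a
    rw [hτ]
    simp only [run_onlyIf, run_store, Expr.eval, h9, h8, h1, h3, hk]
    by_cases ht : G.Touches X v u <;> by_cases hr : G.rank X v u ≤ k <;> simp [ht, hr, ha]
    by_cases hau : a = u <;> simp [hau]
  simp only [run_onlyIf, run_ifZero, run_assign, Expr.eval,
    hmτ.eval_blueExpr ((hregτ 2).trans h2) ((hregτ 3).trans h3), blueEntry_ne_zero, hregτ, h8, h7,
    mem_firsts, huX, not_false_eq_true, true_and]
  by_cases hb : G.blue.Adj v u <;> by_cases hr : G.rank X v u = 0 <;>
    simp only [hb, hr, if_true, if_false, State.setReg_reg, State.setReg_arr, and_self, and_true,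
      true_and, and_false, hregτ, h7, add_zero] <;> simpa [hr] using harr

theorem markFor_spec (h : HasMatrix G k s) (hX : IsIndicator (s.arr 2) X) {v : Fin n}
    (hv : s.reg 2 = v) :
    ((markFor.run s).reg 10 ≠ 0 ↔
      s.reg 10 ≠ 0 ∨ v ∈ X ∧ 2 * k + 1 < (G.firsts X v).card) ∧
    ∀ u : Fin n, (markFor.run s).arr 3 u ≠ 0 ↔
        s.arr 3 u ≠ 0 ∨ u ∉ X ∧ v ∈ X ∧ G.Touches X v u ∧ G.rank X v u ≤ k := by
  classical
  rw [markFor, run_onlyIf]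
  simp only [Expr.eval, hv, hX v]
  by_cases hvX : v ∈ X
  swap
  · simp [hvX]
  simp only [hvX, if_true, run_seq, run_assign, Expr.eval, true_and]
  set τ := s.setReg 7 0 with hτ
  have hmτ : HasMatrix G k τ := h.of_eq (by simp [hτ]) (by simp [hτ]) rfl rfl
  have key := run_each (p := markBody) (x := 3) (s := τ) (fun m σ =>
    σ.reg 7 = ((G.firsts X v).filter fun x => x.val < m).card ∧
    ∀ u : Fin n, σ.arr 3 u ≠ 0 ↔ s.arr 3 u ≠ 0 ∨
      u.val < m ∧ u ∉ X ∧ G.Touches X v u ∧ G.rank X v u ≤ k)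
    (by simp [hτ]) (by
      rintro i hi σ hx hreg harr ⟨h1, h2⟩
      rw [hmτ.reg_zero] at hi
      obtain ⟨h3, h4⟩ := markBody_spec (s := σ) (u := ⟨i, hi⟩) (v := v)
        (hmτ.of_eq (hreg 0 (by decide) (by decide)) (hreg 1 (by decide) (by decide))
          (harr 1 (by decide)) (harr 4 (by decide)))
        (by rw [harr 2 (by decide)]; simpa [hτ] using hX)
        (by rw [hreg 2 (by decide) (by decide)]; simpa [hτ] using hv) hx
      have h5 := Finset.card_filter_val_lt_succ (G.firsts X v) ⟨i, hi⟩
      simp only at h5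
      constructor
      · simp only [State.setReg_reg, h3, h1, h5]
        simp
      · intro u
        rw [State.setReg_arr, h4, h2, or_assoc]
        refine or_congr_right ?_
        constructor
        · rintro (⟨hlt, hs⟩ | ⟨he, hs⟩)
          · exact ⟨by omega, hs⟩
          · obtain rfl : u = ⟨i, hi⟩ := Fin.ext he
            exact ⟨Nat.lt_succ_self i, hs⟩
        · rintro ⟨hlt, hs⟩
          rcases Nat.lt_succ_iff_lt_or_eq.1 hlt with hlt | rfl
          · exact Or.inl ⟨hlt, hs⟩
          · exact Or.inr ⟨rfl, hs⟩)
  rw [hmτ.reg_zero, Finset.filter_true_of_mem fun x _ => x.2] at key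
  set σ := (each 3 markBody).run τ with hσ
  have hσ1 : σ.reg 1 = k := by rw [hσ, run_reg _ _ _ (by decide), hmτ.reg_one]
  have hσ10 : σ.reg 10 = s.reg 10 := by rw [hσ, run_reg _ _ _ (by decide)]; simp [hτ]
  have hlt : (G.firsts X v).card - (k + k + 1) ≠ 0 ↔ 2 * k + 1 < (G.firsts X v).card := by omega
  simp only [run_onlyIf, run_assign, Expr.eval, key.1, hσ1, hlt]
  constructor
  · by_cases hc : 2 * k + 1 < (G.firsts X v).card <;> simp [hc, hσ10]
  · intro u
    have := key.2 u
    simp only [u.2, true_and] at this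
    split_ifs <;> simpa using this

theorem mark_spec (h : HasMatrix G k s) (hX : IsIndicator (s.arr 2) X) (h10 : s.reg 10 = 0)
    (h3 : ∀ i, s.arr 3 i = 0) :
    ((mark.run s).reg 10 ≠ 0 ↔ ∃ v ∈ X, 2 * k + 1 < (G.firsts X v).card) ∧
    ∀ u : Fin n, (mark.run s).arr 3 u ≠ 0 ↔ G.IsMarked X k u := by
  have key := run_each (p := markFor) (x := 2) (s := s) (fun m σ =>
    (σ.reg 10 ≠ 0 ↔ ∃ v : Fin n, v.val < m ∧ v ∈ X ∧ 2 * k + 1 < (G.firsts X v).card) ∧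
    ∀ u : Fin n, σ.arr 3 u ≠ 0 ↔
      ∃ v : Fin n, v.val < m ∧ u ∉ X ∧ v ∈ X ∧ G.Touches X v u ∧ G.rank X v u ≤ k)
    (by simp [h10, h3]) (by
      rintro i hi σ hx hreg harr ⟨h1, h2⟩
      rw [h.reg_zero] at hi
      obtain ⟨h4, h5⟩ := markFor_spec (s := σ) (v := ⟨i, hi⟩)
        (h.of_eq (hreg 0 (by decide) (by decide)) (hreg 1 (by decide) (by decide))
          (harr 1 (by decide)) (harr 4 (by decide)))
        (by rw [harr 2 (by decide)]; exact hX) hx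
      have hstep : ∀ P : Fin n → Prop, ((∃ v : Fin n, v.val < i ∧ P v) ∨ P ⟨i, hi⟩ ↔
          ∃ v : Fin n, v.val < i + 1 ∧ P v) := by
        intro P
        constructor
        · rintro (⟨v, hv, hP⟩ | hP)
          · exact ⟨v, by omega, hP⟩
          · exact ⟨_, Nat.lt_succ_self i, hP⟩
        · rintro ⟨v, hv, hP⟩
          rcases Nat.lt_succ_iff_lt_or_eq.1 hv with hv | rfl
          · exact Or.inl ⟨v, hv, hP⟩
          · exact Or.inr hP
      constructor
      · rw [State.setReg_reg, if_neg (by decide), h4, h1]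
        exact hstep _
      · intro u
        rw [State.setReg_arr, h5, h2]
        exact hstep _)
  rw [h.reg_zero] at key
  refine ⟨key.1.trans (by simp), fun u => (key.2 u).trans ?_⟩
  simp [CorrelationGraph.IsMarked]

end RAM

/-! ### Writing the kernel -/

/-- The correlation graph with the given blue edges. -/
def CorrelationGraph.ofBlue {V : Type*} (B : SimpleGraph V) : CorrelationGraph V where
  blue := B
  red := Bᶜ
  disjoint := fun _ _ h h' => h'.2 h
  complete := fun x y h => (em (B.Adj x y)).imp_right fun hb => ⟨h, hb⟩

namespace RAM

open LoopProgram

variable {n : ℕ} {G : CorrelationGraph (Fin n)} {k : ℕ} {s : State}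

/-- Nonzero if the vertex in register `x` belongs to the kernel. -/
def keptExpr (x : ℕ) : Expr := .add (.load 2 (.reg x)) (.load 3 (.reg x))

def extractBody : LoopProgram :=
  .onlyIf (keptExpr 3) <| .seq (.store 0 (.reg 11) (blueExpr 2 3)) <|
  .assign 11 (.add (.reg 11) (.const 1))

/-- Write the adjacency matrix of the kernel to array `0` and its number of rows to
register `12`. -/
def extract : LoopProgram :=
  .seq (.assign 11 (.const 0)) <| .seq (.assign 12 (.const 0)) <| .each 2 <|
  .onlyIf (keptExpr 2) <| .seq (.each 3 extractBody) <| .assign 12 (.add (.reg 12) (.const 1))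

/-- `Nat.count q j` is the index of `j` among the kept vertices. The write position in register `11`
only increases, so earlier rows survive. -/
theorem extractRow_spec (h : HasMatrix G k s) {q : ℕ → Prop} [DecidablePred q]
    (hq : ∀ a, s.arr 2 a + s.arr 3 a ≠ 0 ↔ q a) {i : ℕ} (hi : i < n) (h2 : s.reg 2 = i) :
    ((each 3 extractBody).run s).reg 11 = s.reg 11 + Nat.count q n ∧
    (∀ a < s.reg 11, ((each 3 extractBody).run s).arr 0 a = s.arr 0 a) ∧
    ∀ j < n, q j → ((each 3 extractBody).run s).arr 0 (s.reg 11 + Nat.count q j) =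
      s.arr 4 (i * n + j) := by
  have key := run_each (p := extractBody) (x := 3) (s := s) (fun m σ =>
    σ.reg 11 = s.reg 11 + Nat.count q m ∧ (∀ a < s.reg 11, σ.arr 0 a = s.arr 0 a) ∧
    ∀ j < m, q j → σ.arr 0 (s.reg 11 + Nat.count q j) = s.arr 4 (i * n + j))
    (by simp) (by
      rintro j hj σ hx hreg harr ⟨h3, h4, h5⟩
      have e2 : σ.reg 2 = i := (hreg 2 (by decide) (by decide)).trans h2
      simp only [extractBody, run_onlyIf, run_seq, run_store, run_assign, keptExpr, blueExpr,
        Expr.eval, hx, e2, harr 1 (by decide), harr 2 (by decide), harr 3 (by decide),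
        harr 4 (by decide), h.offset i hi, State.setReg_reg, State.setReg_arr, hq, Nat.count_succ]
      by_cases hqj : q j
      · simp only [hqj, if_true, State.setReg_reg, State.setReg_arr, State.setCell_reg,
          State.setCell_arr, true_and, h3]
        refine ⟨rfl, fun a ha => ?_, fun j' hj' hq' => ?_⟩
        · rw [if_neg (by omega), h4 a ha]
        · rcases Nat.lt_succ_iff_lt_or_eq.1 hj' with hlt | rfl
          · have := Nat.count_strict_mono hq' hlt
            rw [if_neg (by omega), h5 j' hlt hq']
          · rw [if_pos rfl]
      · simp only [hqj, if_false, add_zero]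
        refine ⟨by simpa using h3, h4, fun j' hj' hq' => ?_⟩
        rcases Nat.lt_succ_iff_lt_or_eq.1 hj' with hlt | rfl
        · exact h5 j' hlt hq'
        · contradiction)
  rwa [h.reg_zero] at key

theorem extract_spec (h : HasMatrix G k s) {q : ℕ → Prop} [DecidablePred q]
    (hq : ∀ a, s.arr 2 a + s.arr 3 a ≠ 0 ↔ q a) :
    (extract.run s).reg 12 = Nat.count q n ∧
    ∀ i < n, ∀ j < n, q i → q j →
      (extract.run s).arr 0 (Nat.count q i * Nat.count q n + Nat.count q j) =
        s.arr 4 (i * n + j) := by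
  simp only [extract, run_seq, run_assign, Expr.eval]
  set τ := (s.setReg 11 0).setReg 12 0 with hτ
  have hmτ : HasMatrix G k τ := h.of_eq (by simp [hτ]) (by simp [hτ]) rfl rfl
  have key := run_each (p := .onlyIf (keptExpr 2) <| .seq (.each 3 extractBody) <|
      .assign 12 (.add (.reg 12) (.const 1))) (x := 2) (s := τ) (fun m σ =>
    σ.reg 12 = Nat.count q m ∧ σ.reg 11 = Nat.count q m * Nat.count q n ∧
    ∀ i < m, ∀ j < n, q i → q j →
      σ.arr 0 (Nat.count q i * Nat.count q n + Nat.count q j) = s.arr 4 (i * n + j))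
    (by simp [hτ]) (by
      rintro i hi σ hx hreg harr ⟨h1, h2, h3⟩
      rw [hmτ.reg_zero] at hi
      have hmσ : HasMatrix G k σ := hmτ.of_eq (hreg 0 (by decide) (by decide))
        (hreg 1 (by decide) (by decide)) (harr 1 (by decide)) (harr 4 (by decide))
      have hqσ : ∀ a, σ.arr 2 a + σ.arr 3 a ≠ 0 ↔ q a := by
        rw [harr 2 (by decide), harr 3 (by decide)]
        exact hq
      obtain ⟨h4, h5, h6⟩ := extractRow_spec hmσ hqσ hi hx
      have h12 : ((each 3 extractBody).run σ).reg 12 = σ.reg 12 := run_reg _ _ _ (by decide)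
      have ha4 : σ.arr 4 = s.arr 4 := harr 4 (by decide)
      simp only [run_onlyIf, run_seq, run_assign, keptExpr, Expr.eval, hx, hqσ, h12,
        Nat.count_succ]
      by_cases hqi : q i
      · simp only [hqi, if_true, State.setReg_reg, State.setReg_arr, h1, h2, h4]
        refine ⟨by simp, by simp [Nat.succ_mul], fun i' hi' j hj hqi' hqj => ?_⟩
        have hj' := Nat.count_strict_mono hqj hj
        rcases Nat.lt_succ_iff_lt_or_eq.1 hi' with hlt | rfl
        · have hi'' : Nat.count q i' + 1 ≤ Nat.count q i := Nat.count_strict_mono hqi' hlt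
          have := Nat.mul_le_mul_right (Nat.count q n) hi''
          rw [Nat.succ_mul] at this
          rw [h5 _ (by omega), h3 i' hlt j hj hqi' hqj]
        · rw [← h2, h6 j hj hqj, ha4]
      · simp only [hqi, if_false, add_zero, State.setReg_reg, State.setReg_arr]
        refine ⟨by simpa using h1, by simpa using h2, fun i' hi' j hj hqi' hqj => ?_⟩
        rcases Nat.lt_succ_iff_lt_or_eq.1 hi' with hlt | rfl
        · exact h3 i' hlt j hj hqi' hqj
        · contradiction)
  rw [hmτ.reg_zero] at key
  exact ⟨key.1, key.2.2⟩

/-- Write a graph which consists of a bad triple. -/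
def writeBadTriple : LoopProgram :=
  .seq (.assign 12 (.const 3)) <| .seq (.assign 1 (.const 0)) <|
  .seq (.store 0 (.const 0) (.const 0)) <| .seq (.store 0 (.const 1) (.const 1)) <|
  .seq (.store 0 (.const 2) (.const 0)) <| .seq (.store 0 (.const 3) (.const 1)) <|
  .seq (.store 0 (.const 4) (.const 0)) <| .seq (.store 0 (.const 5) (.const 1)) <|
  .seq (.store 0 (.const 6) (.const 0)) <| .seq (.store 0 (.const 7) (.const 1)) <|
  .store 0 (.const 8) (.const 0)

theorem writeBadTriple_spec (s : State) : ∃ G' : CorrelationGraph (Fin 3),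
    Holds ((writeBadTriple.run s).setReg 0 ((writeBadTriple.run s).reg 12)) G' 0 ∧
      ¬ G'.IsYesInstance 0 := by
  refine ⟨.ofBlue (SimpleGraph.fromRel fun i j : Fin 3 => i.val + 1 = j.val),
    ⟨?_, ?_, fun i j => ?_⟩, ?_⟩
  · simp [writeBadTriple, run_seq, run_assign, run_store, Expr.eval]
  · simp [writeBadTriple, run_seq, run_assign, run_store, Expr.eval]
  · fin_cases i <;> fin_cases j <;>
      simp [writeBadTriple, run_seq, run_assign, run_store, Expr.eval, blueEntry,
        CorrelationGraph.ofBlue]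
  · refine CorrelationGraph.IsBadTriple.not_isYesInstance (i := 0) (j := 1) (l := 2) ?_
    simp [CorrelationGraph.IsBadTriple, CorrelationGraph.ofBlue]

/-! ### The kernelization -/

/-- Decide whether there are too many disjoint bad triples or too many blue neighbours, and write
the result; its number of vertices is left in register `12`. -/
def kernelize : LoopProgram :=
  .seq loadMatrix <| .seq pack <| .seq mark <|
  .seq (.onlyIf (.sub (.reg 6) (.reg 1)) (.assign 10 (.const 1))) <|
  .ite (.reg 10) writeBadTriple extract

theorem isSafe_kernelize : kernelize.IsSafe := by
  simp [kernelize, loadMatrix, pack, packBody, mark, markFor, markBody, scan, scanBody, extract,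
    extractBody, writeBadTriple, IsSafe, regs, onlyIf, ifZero]

theorem kernelize_spec (h : IsInitial s G k) :
    ∃ (n' k' : ℕ) (G' : CorrelationGraph (Fin n')),
      Holds ((kernelize.run s).setReg 0 ((kernelize.run s).reg 12)) G' k' ∧
      (G.IsYesInstance k ↔ G'.IsYesInstance k') ∧ k' ≤ k ∧
      (n' ≤ 24 * k ^ 3 + 24 * k ^ 2 + 3 * k ∨ (k = 0 ∧ ¬ G.IsYesInstance k ∧ n' ≤ 3)) := by
  simp only [kernelize, run_seq]
  have hm1 := hasMatrix_loadMatrix h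
  set s1 := loadMatrix.run s with hs1
  have hr1 : ∀ x, x ∉ loadMatrix.regs → 2 ≤ x → s1.reg x = 0 := fun x hx hx2 => by
    rw [hs1, run_reg _ _ _ hx, h.reg_rest x hx2]
  have ha1 : ∀ a, a ∉ loadMatrix.arrs → 1 ≤ a → ∀ i, s1.arr a i = 0 := fun a ha ha1 i => by
    rw [hs1, run_arr _ _ _ ha, h.arr_rest a i ha1]
  have hpack : IsPacking G k s1 := by
    refine ⟨hm1, ∅, fun i => ?_, ?_, ?_⟩
    · simp [ha1 2 (by decide) (by decide)]
    · rw [hr1 6 (by decide) (by decide)]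
      exact CorrelationGraph.forcesSplits_empty
    · simp
  obtain ⟨X, hX, hX2, hforce, hcard⟩ := pack_spec hpack
  have hm2 : HasMatrix G k (pack.run s1) := hm1.run (by decide) (by decide) (by decide) (by decide)
  set s2 := pack.run s1 with hs2
  obtain ⟨h10, h3⟩ := mark_spec hm2 hX2
    (by rw [hs2, run_reg _ _ _ (by decide), hr1 10 (by decide) (by decide)])
    (by rw [hs2, run_arr _ _ _ (by decide)]; exact ha1 3 (by decide) (by decide))
  have hm3 : HasMatrix G k (mark.run s2) := hm2.run (by decide) (by decide) (by decide) (by decide)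
  have hX3 : IsIndicator ((mark.run s2).arr 2) X := by rwa [run_arr _ _ _ (by decide)]
  have h6 : (mark.run s2).reg 6 = s2.reg 6 := run_reg _ _ _ (by decide)
  set s3 := mark.run s2
  have hm4 : HasMatrix G k ((onlyIf (.sub (.reg 6) (.reg 1)) (assign 10 (.const 1))).run s3) :=
    hm3.run (by decide) (by decide) (by decide) (by decide)
  have ha4 : ((onlyIf (.sub (.reg 6) (.reg 1)) (assign 10 (.const 1))).run s3).arr = s3.arr := by
    ext a i
    rw [run_arr _ _ _ (by simp [onlyIf, arrs])]
  have h10' : ((onlyIf (.sub (.reg 6) (.reg 1)) (assign 10 (.const 1))).run s3).reg 10 ≠ 0 ↔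
      k < s2.reg 6 ∨ ∃ v ∈ X, 2 * k + 1 < (G.firsts X v).card := by
    rw [← h10]
    simp only [run_onlyIf, run_assign, Expr.eval, h6, hm3.reg_one]
    split_ifs with hc
    · simp only [State.setReg_reg, if_true]
      exact iff_of_true one_ne_zero (Or.inl (by omega))
    · exact (or_iff_right (by omega)).symm
  set s4 := (onlyIf (.sub (.reg 6) (.reg 1)) (assign 10 (.const 1))).run s3
  by_cases hbad : s4.reg 10 ≠ 0
  · rw [show (LoopProgram.ite (.reg 10) writeBadTriple extract).run s4 = writeBadTriple.run s4 from
      if_pos hbad]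
    have hno : ¬ G.IsYesInstance k := by
      intro hyes
      rcases h10'.1 hbad with hlt | ⟨v, -, hlt⟩
      · have := hforce.le hyes
        omega
      · have := CorrelationGraph.card_firsts_le (X := X) hyes v
        omega
    obtain ⟨G', hG', hno'⟩ := writeBadTriple_spec s4
    refine ⟨3, 0, G', hG', iff_of_false hno hno', Nat.zero_le _, ?_⟩
    -- For `k ≥ 1` the three vertices fit below `3k`; only `k = 0` needs the exceptional case.
    rcases Nat.eq_zero_or_pos k with rfl | hk
    · exact Or.inr ⟨rfl, hno, le_rfl⟩
    · exact Or.inl (by omega)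
  · rw [show (LoopProgram.ite (.reg 10) writeBadTriple extract).run s4 = extract.run s4 from
      if_neg hbad]
    rw [h10', not_or, not_lt] at hbad
    push Not at hbad
    set q : ℕ → Prop := fun a => s4.arr 2 a + s4.arr 3 a ≠ 0
    have hq : ∀ x : Fin n, q x ↔ G.IsKept X k x := by
      intro x
      have h1 := hX3 x
      have h2 := h3 x
      simp only [q, ha4, CorrelationGraph.IsKept, ← h1, ← h2]
      omega
    obtain ⟨h12, hmat⟩ := extract_spec hm4 (q := q) fun a => Iff.rfl
    have hlt : ∀ a : Fin (Nat.count q n), ∀ hf : (Set.ofPred q).Finite, a.val < hf.toFinset.card :=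
      fun a hf => a.2.trans_le (Nat.count_le_card hf n)
    -- The increasing enumeration of the kept vertices, inverse to the index `Nat.count q` used by
    -- `extract`.
    let e : Fin (Nat.count q n) → Fin n := fun a => ⟨Nat.nth q a, Nat.nth_lt_of_lt_count a.2⟩
    have hqe : ∀ a, q (e a) := fun a => Nat.nth_mem _ (hlt a)
    have hcount : ∀ a, Nat.count q (e a) = a := fun a => Nat.count_nth (hlt a)
    have he : Function.Injective e := fun a b hab => Fin.ext (by rw [← hcount, ← hcount b, hab])
    have hrange : ∀ x, G.IsKept X k x ↔ ∃ a, e a = x := by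
      intro x
      rw [← hq]
      constructor
      · intro hx
        exact ⟨⟨Nat.count q x, Nat.count_strict_mono hx x.2⟩, Fin.ext (Nat.nth_count hx)⟩
      · rintro ⟨a, rfl⟩
        exact hqe a
    refine ⟨Nat.count q n, k, .ofBlue (G.blue.comap e), ⟨?_, ?_, fun a b => ?_⟩,
      CorrelationGraph.isYesInstance_iff_of_isKept hX he hrange fun a b => Iff.rfl, le_rfl,
      Or.inl ?_⟩
    · simpa using h12
    · rw [State.setReg_reg, if_neg (by decide), run_reg _ _ _ (by decide), hm4.reg_one]
    · have := hmat (e a) (e a).2 (e b) (e b).2 (hqe a) (hqe b)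
      rw [hcount, hcount, hm4.matrix] at this
      rw [State.setReg_arr, this]
      rfl
    · classical
      have hK := CorrelationGraph.card_le_of_isKept hX (K := Finset.univ.image e) (k := k)
        (fun x hx => by
          obtain ⟨a, _, ha⟩ := Finset.mem_image.1 hx
          exact (hrange x).2 ⟨a, ha⟩) (by omega) hbad.2
      rwa [Finset.card_image_of_injective _ he, Finset.card_univ, Fintype.card_fin] at hK

end RAM

/-! ### The time bound and the final statement -/

theorem Polynomial.eval_le_eval_nat (T : Polynomial ℕ) {a b : ℕ} (h : a ≤ b) :
    T.eval a ≤ T.eval b := by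
  rw [Polynomial.eval_eq_sum_range, Polynomial.eval_eq_sum_range]
  gcongr

theorem mainTheorem1 :
    ∃ (p : RAM.Program) (T : Polynomial ℕ),
      ∀ (n : ℕ) (G : CorrelationGraph (Fin n)) (k : ℕ) (s : RAM.State), RAM.IsInitial s G k →
        ∃ (t : ℕ) (s' : RAM.State) (n' k' : ℕ) (G' : CorrelationGraph (Fin n')),
          RAM.Run p s t s' ∧
          t ≤ T.eval (n + Nat.size k) ∧
          RAM.Holds s' G' k' ∧
          (G.IsYesInstance k ↔ G'.IsYesInstance k') ∧
          k' ≤ k ∧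
          (n' ≤ 24 * k ^ 3 + 24 * k ^ 2 + 3 * k ∨
            (k = 0 ∧ ¬ G.IsYesInstance k ∧ n' ≤ 3)) := by
  obtain ⟨T, hT⟩ := RAM.LoopProgram.exists_run_compile _ RAM.isSafe_kernelize
  -- Register `0` bounds all loops, so the new number of vertices is moved there only at the end, at
  -- cost 2.
  refine ⟨.seq RAM.kernelize.compile (.assign 0 (.reg 12)), T + .C 2, fun n G k s h => ?_⟩
  obtain ⟨t, ht, hr⟩ := hT s
  obtain ⟨n', k', G', hG'⟩ := RAM.kernelize_spec h
  refine ⟨_, _, n', k', G', .seq hr (.assign _ _ _), ?_, hG'⟩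
  rw [h.reg_zero] at ht
  have := T.eval_le_eval_nat (Nat.le_add_right n (Nat.size k))
  simp only [Polynomial.eval_add, Polynomial.eval_C, RAM.Expr.cost]
  omega
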